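/- Let $G$ be a discrete group and $H\le G$ a subgroup. An affine $G$-flow is a compact convex subset $K$ of a locally convex Hausdorff real topological vector space, with a $G$-action on $K$ by affine homeomorphisms; a $G$-morphism is an equivariant continuous affine map. An affine $(G,H)$-flow is an affine $G$-flow with an $H$-fixed point; it is $(G,H)$-irreducible if no proper compact convex $G$-invariant subset of it contains an $H$-fixed point. Let $\Delta(G,H)$ be the universal $(G,H)$-irreducible affine flow, i.e. a $(G,H)$-irreducible affine flow with a $G$-morphism onto every $(G,H)$-irreducible affine flow (it exists), and let $\partial(G,H)=\mathrm{Ext}(\Delta(G,H))$ be its set of extremal points, with the induced topology and $G$-action. (1) Suppose that $H$ is non-amenable but that $H\cap gHg^{-1}$ is amenable for every $g\in G\setminus H$. Then $\partial(G,H)\cong\beta(G/H)$, the Stone–Čech compactification of the discrete $G$-set $G/H$, by a $G$-equivariant homeomorphism. The condition on the intersections holds in particular if $H$ is malnormal ($H\cap gHg^{-1}=1$ for all $g\notin H$) or almost malnormal ($H\cap gHg^{-1}$ finite for all $g\notin H$). (2) If $H$ is amenable, then $\partial(G,H)\cong\partial(G)$ by a $G$-equivariant homeomorphism, where $\partial(G)$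 is the classical Furstenberg boundary, i.e. the universal minimal strongly proximal compact Hausdorff $G$-flow. -/

import Mathlib

open MeasureTheory
open scoped BoundedContinuousFunction

universe u v w x

/-! ### Affine flows -/

/-- An affine `G`-flow of a topological group `G`: a compact convex subset `carrier` of a locally
convex Hausdorff real topological vector space `E`, with a (jointly continuous) action of `G` on
`carrier` that preserves convex combinations. The action is not assumed to extend to `E`. -/
structure AffineFlow (G : Type u) [Group G] [TopologicalSpace G] where
  /-- the ambient topological vector space -/
  E : Type v
  [addCommGroup : AddCommGroup E]
  [module : Module ℝ E]
  [topologicalSpace : TopologicalSpace E]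
  [isTopologicalAddGroup : IsTopologicalAddGroup E]
  [continuousSMulReal : ContinuousSMul ℝ E]
  [locallyConvexSpace : LocallyConvexSpace ℝ E]
  [t2Space : T2Space E]
  /-- the compact convex set -/
  carrier : Set E
  isCompact : IsCompact carrier
  convex : Convex ℝ carrier
  [mulAction : MulAction G carrier]
  [continuousSMul : ContinuousSMul G carrier]
  smul_affine : ∀ (g : G) (x y z : carrier) (a b : ℝ), 0 ≤ a → 0 ≤ b → a + b = 1 →
    (z : E) = a • (x : E) + b • (y : E) →
      ((g • z : carrier) : E) = a • ((g • x : carrier) : E) + b • ((g • y : carrier) : E)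

namespace AffineFlow

attribute [instance] addCommGroup module topologicalSpace isTopologicalAddGroup
  continuousSMulReal locallyConvexSpace t2Space mulAction continuousSMul

variable {G : Type u} [Group G] [TopologicalSpace G]

/-- `f` is a `G`-morphism: an equivariant continuous affine map. -/
structure IsMorphism (K : AffineFlow.{u, v} G) (L : AffineFlow.{u, w} G)
    (f : K.carrier → L.carrier) : Prop where
  continuous : Continuous f
  map_smul : ∀ (g : G) (x : K.carrier), f (g • x) = g • f x
  map_affine : ∀ (x y z : K.carrier) (a b : ℝ), 0 ≤ a → 0 ≤ b → a + b = 1 →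
    (z : K.E) = a • (x : K.E) + b • (y : K.E) →
      (f z : L.E) = a • (f x : L.E) + b • (f y : L.E)

/-- An affine `(G, H)`-flow is an affine `G`-flow with an `H`-fixed point. -/
def IsRelFlow (H : Subgroup G) (K : AffineFlow.{u, v} G) : Prop :=
  ∃ x : K.carrier, ∀ h ∈ H, h • x = x

/-- `(G, H)`-irreducibility: `K` is an affine `(G, H)`-flow, and every closed (that is, compact)
convex `G`-invariant subset that contains an `H`-fixed point is all of `K`. -/
def IsIrreducible (H : Subgroup G) (K : AffineFlow.{u, v} G) : Prop :=
  K.IsRelFlow H ∧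
    ∀ L : Set K.carrier, IsClosed L → Convex ℝ ((↑) '' L : Set K.E) →
      (∀ (g : G), ∀ x ∈ L, g • x ∈ L) → (∃ x ∈ L, ∀ h ∈ H, h • x = x) → L = Set.univ

/-- `K` is (a model of) `Δ(G, H)`: it is a `(G, H)`-irreducible affine flow that has a
`G`-morphism onto every `(G, H)`-irreducible affine flow (in a space of universe `v`). -/
def IsUniversalIrreducible (H : Subgroup G) (K : AffineFlow.{u, w} G) : Prop :=
  K.IsIrreducible H ∧
    ∀ L : AffineFlow.{u, v} G, L.IsIrreducible H →
      ∃ f : K.carrier → L.carrier, K.IsMorphism L f ∧ Function.Surjective f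

/-- The set of extremal points of `K`, with the topology and the `G`-action of `K`. When `K` is
`Δ(G, H)`, this is the Furstenberg boundary `∂(G, H)`. -/
abbrev Ext (K : AffineFlow.{u, v} G) : Type v :=
  {x : K.carrier // (x : K.E) ∈ Set.extremePoints ℝ K.carrier}

theorem smul_mem_ext (K : AffineFlow.{u, v} G) (g : G) {x : K.carrier}
    (hx : (x : K.E) ∈ Set.extremePoints ℝ K.carrier) :
    ((g • x : K.carrier) : K.E) ∈ Set.extremePoints ℝ K.carrier := by
  rw [mem_extremePoints_iff_left] at hx ⊢
  refine ⟨(g • x).2, ?_⟩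
  rintro y hy z hz ⟨a, b, ha, hb, hab, h⟩
  have h1 := K.smul_affine g⁻¹ ⟨y, hy⟩ ⟨z, hz⟩ (g • x) a b ha.le hb.le hab h.symm
  rw [inv_smul_smul] at h1
  have h2 := hx.2 _ (g⁻¹ • (⟨y, hy⟩ : K.carrier)).2 _ (g⁻¹ • (⟨z, hz⟩ : K.carrier)).2
    ⟨a, b, ha, hb, hab, h1.symm⟩
  rw [← Subtype.ext h2, smul_inv_smul]

instance (K : AffineFlow.{u, v} G) : MulAction G K.Ext where
  smul g x := ⟨g • x.1, K.smul_mem_ext g x.2⟩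
  one_smul x := Subtype.ext (one_smul G x.1)
  mul_smul g h x := Subtype.ext (mul_smul g h x.1)

end AffineFlow

/-! ### The Stone–Čech compactification of a `G`-space -/

/-- The action on the Stone–Čech compactification that extends the action on `α`. -/
noncomputable instance StoneCech.instMulActionOfConst {G : Type u} [Group G] {α : Type v}
    [TopologicalSpace α] [MulAction G α] [ContinuousConstSMul G α] :
    MulAction G (StoneCech α) where
  smul g := stoneCechExtend
    ((continuous_stoneCechUnit (α := α)).comp (continuous_const_smul g))
  one_smul y := by
    refine congrFun (stoneCech_hom_ext (g₂ := id) (continuous_stoneCechExtend _)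
      continuous_id ?_) y
    rw [stoneCechExtend_extends]
    funext a
    simp
  mul_smul g h y := by
    refine congrFun (stoneCech_hom_ext (continuous_stoneCechExtend _)
      ((continuous_stoneCechExtend ((continuous_stoneCechUnit (α := α)).comp
        (continuous_const_smul g))).comp (continuous_stoneCechExtend
          ((continuous_stoneCechUnit (α := α)).comp (continuous_const_smul h)))) ?_) y
    rw [stoneCechExtend_extends]
    funext a
    simp [mul_smul]

/-! ### The classical boundary -/

/-- Strong proximality: the closure of the orbit of every (regular Borel) probability measure
contains a Dirac mass, for the weak topology given by the continuous functions. -/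
def StronglyProximal (G : Type u) [Group G] (X : Type v) [TopologicalSpace X]
    [MulAction G X] : Prop :=
  letI : MeasurableSpace X := borel X
  haveI : BorelSpace X := ⟨rfl⟩
  ∀ μ : ProbabilityMeasure X, (μ : Measure X).Regular →
    ∃ x : X, diracProba x ∈ closure {ν : ProbabilityMeasure X |
      ∃ g : G, (ν : Measure X) = (μ : Measure X).map (fun y => g • y)}

/-- A (classical) `G`-boundary: a non-empty compact Hausdorff `G`-flow that is minimal and strongly
proximal. -/
structure IsClassicalBoundary (G : Type u) [Group G] [TopologicalSpace G] (X : Type v)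
    [TopologicalSpace X] [MulAction G X] : Prop where
  nonempty : Nonempty X
  compactSpace : CompactSpace X
  t2Space : T2Space X
  continuousSMul : ContinuousSMul G X
  isMinimal : MulAction.IsMinimal G X
  stronglyProximal : StronglyProximal G X

/-- `X` is (a model of) the Furstenberg boundary `∂(G)`: it is a `G`-boundary that has a
continuous `G`-map to every `G`-boundary (of universe `v`). Such maps are onto by minimality. -/
def IsFurstenbergBoundary (G : Type u) [Group G] [TopologicalSpace G] (X : Type w)
    [TopologicalSpace X] [MulAction G X] : Prop :=
  IsClassicalBoundary G X ∧
    ∀ (Y : Type v) [TopologicalSpace Y] [MulAction G Y], IsClassicalBoundary G Y →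
      ∃ f : X → Y, Continuous f ∧ ∀ (g : G) (x : X), f (g • x) = g • f x

/-! ### Amenability of discrete groups, malnormality -/

/-- A discrete group is amenable if there is a left invariant mean on its bounded real
functions. -/
def DiscreteAmenable (Γ : Type u) [Group Γ] [TopologicalSpace Γ] [DiscreteTopology Γ] : Prop :=
  ∃ m : (Γ →ᵇ ℝ) →ₗ[ℝ] ℝ, (∀ f : Γ →ᵇ ℝ, (∀ t, 0 ≤ f t) → 0 ≤ m f) ∧
    m (BoundedContinuousFunction.const Γ 1) = 1 ∧
    ∀ (g : Γ) (f : Γ →ᵇ ℝ),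
      m (f.compContinuous ⟨fun t => g * t, continuous_of_discreteTopology⟩) = m f

namespace Subgroup

variable {G : Type u} [Group G]

/-- The conjugate `g H g⁻¹`. -/
abbrev conjBy (H : Subgroup G) (g : G) : Subgroup G :=
  H.map (MulAut.conj g).toMonoidHom

/-- `H` is malnormal: `H ∩ g H g⁻¹` is trivial for all `g ∉ H`. -/
def IsMalnormalIn (H : Subgroup G) : Prop :=
  ∀ g : G, g ∉ H → H ⊓ H.conjBy g = ⊥

/-- `H` is almost malnormal: `H ∩ g H g⁻¹` is finite for all `g ∉ H`. -/
def IsAlmostMalnormalIn (H : Subgroup G) : Prop :=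
  ∀ g : G, g ∉ H → Finite (H ⊓ H.conjBy g : Subgroup G)

end Subgroup

/-! The states on a compact `G`-space `X` form an affine flow whose extremal points are the points
of `X`, and by barycentres every equivariant continuous map from `X` to an affine flow extends to a
morphism from the states. An `H`-fixed point of an affine flow `L` gives an orbit map `G ⧸ H → L`,
hence a map from the Stone–Čech compactification, hence a morphism from its flow of states. So any
irreducible subflow of the states on `StoneCech (G ⧸ H)`, which Zorn provides, is universal.
Irreducible flows are rigid: an endomorphism fixes some `H`-fixed point by Markov–Kakutani, so its
fixed points are everything. Universal flows are therefore isomorphic, and it suffices to know one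
model.

Non-amenable `H`: an `H`-fixed state on `StoneCech (G ⧸ H)` is an `H`-invariant mean on `G ⧸ H`. If
it is not the point mass at the coset `H`, it charges the other cosets, whose stabilizers in `H` are
the amenable groups `H ∩ gHg⁻¹`. These provide an equivariant family of means on `H`; averaging it
makes `H` amenable (`discreteAmenable_of_fixed_state`). So the point mass is the only fixed state,
and as its translates are dense in the extremal points, the whole flow of states is irreducible.

Amenable `H`: every non-empty affine flow has an `H`-fixed point, so irreducibility for `H` is
irreducibility for the trivial group. The closure of the extremal points of such a flow is a
boundary, by the theorems of Milman and Bauer; conversely the states of a boundary are irreducible.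
This carries one universal property to the other, and rigidity identifies a universal flow `D` with
the states on `D.extClosure`, so that its extremal points are already closed. -/

/-! ### Affine maps between convex sets -/

section ConvexSets

variable {E : Type*} [AddCommGroup E] [Module ℝ E] {F : Type*} [AddCommGroup F] [Module ℝ F]
  {E' : Type*} [AddCommGroup E'] [Module ℝ E']

/-- A map between subsets of real vector spaces that preserves convex combinations. -/
def PreservesConvexComb {S : Set E} {T : Set F} (f : S → T) : Prop :=
  ∀ (x y z : S) (a b : ℝ), 0 ≤ a → 0 ≤ b → a + b = 1 → (z : E) = a • (x : E) + b • (y : E) →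
    (f z : F) = a • (f x : F) + b • (f y : F)

namespace PreservesConvexComb

variable {S : Set E} {T : Set F} {U : Set E'}

theorem id : PreservesConvexComb (fun x : S => x) := fun _ _ _ _ _ _ _ _ h => h

theorem comp {g : T → U} {f : S → T} (hg : PreservesConvexComb g) (hf : PreservesConvexComb f) :
    PreservesConvexComb (fun x => g (f x)) :=
  fun x y z a b ha hb hab h => hg _ _ _ a b ha hb hab (hf x y z a b ha hb hab h)

theorem convex_preimage (hS : Convex ℝ S) {f : S → T} (hf : PreservesConvexComb f) {V : Set T}
    (hV : Convex ℝ ((↑) '' V : Set F)) : Convex ℝ ((↑) '' (f ⁻¹' V) : Set E) := by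
  rintro _ ⟨x, hx, rfl⟩ _ ⟨y, hy, rfl⟩ a b ha hb hab
  refine ⟨⟨a • (x : E) + b • (y : E), hS x.2 y.2 ha hb hab⟩, ?_, rfl⟩
  obtain ⟨z, hz, hz'⟩ := hV ⟨f x, hx, rfl⟩ ⟨f y, hy, rfl⟩ ha hb hab
  have : z = f ⟨a • (x : E) + b • (y : E), hS x.2 y.2 ha hb hab⟩ :=
    Subtype.ext (hz'.trans (hf x y _ a b ha hb hab rfl).symm)
  rw [Set.mem_preimage, ← this]
  exact hz

theorem convex_image {f : S → T} (hf : PreservesConvexComb f) {V : Set S}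
    (hV : Convex ℝ ((↑) '' V : Set E)) : Convex ℝ ((↑) '' (f '' V) : Set F) := by
  rintro _ ⟨_, ⟨x, hx, rfl⟩, rfl⟩ _ ⟨_, ⟨y, hy, rfl⟩, rfl⟩ a b ha hb hab
  obtain ⟨z, hz, hz'⟩ := hV ⟨x, hx, rfl⟩ ⟨y, hy, rfl⟩ ha hb hab
  exact ⟨f z, ⟨z, hz, rfl⟩, hf x y z a b ha hb hab hz'⟩

/-- The source of the uniqueness results below: an equaliser that is closed and convex is everything
once it contains the extremal points, or, in an irreducible flow, once it is invariant and contains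
a fixed point. -/
theorem convex_eqLocus (hS : Convex ℝ S) {f g : S → T} (hf : PreservesConvexComb f)
    (hg : PreservesConvexComb g) : Convex ℝ ((↑) '' {x | f x = g x} : Set E) := by
  rintro _ ⟨x, hx, rfl⟩ _ ⟨y, hy, rfl⟩ a b ha hb hab
  refine ⟨⟨a • (x : E) + b • (y : E), hS x.2 y.2 ha hb hab⟩, ?_, rfl⟩
  refine Subtype.ext ?_
  rw [hf x y _ a b ha hb hab rfl, hg x y _ a b ha hb hab rfl, hx, hy]

end PreservesConvexComb

variable [TopologicalSpace E] [TopologicalSpace F]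

/-- A closed convex subset of a compact convex set contains the closed convex hull of its
subsets. -/
theorem mem_of_mem_closure_convexHull {S : Set E} (hS : IsCompact S) [T2Space E] {L A : Set S}
    (hL : IsClosed L) (hLc : Convex ℝ ((↑) '' L : Set E)) (hA : A ⊆ L) {x : S}
    (hx : (x : E) ∈ closure (convexHull ℝ ((↑) '' A : Set E))) : x ∈ L := by
  have hc : IsClosed ((↑) '' L : Set E) := by
    have := isCompact_iff_compactSpace.1 hS
    exact (hL.isCompact.image continuous_subtype_val).isClosed
  obtain ⟨y, hy, hyx⟩ :=
    closure_minimal (convexHull_min (Set.image_mono hA) hLc) hc hx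
  exact Subtype.ext hyx ▸ hy

variable [IsTopologicalAddGroup E] [ContinuousSMul ℝ E] [LocallyConvexSpace ℝ E] [T2Space E]

theorem eq_univ_of_extremePoints_subset {S : Set E} (hS : IsCompact S) (hSc : Convex ℝ S)
    {L : Set S} (hL : IsClosed L) (hLc : Convex ℝ ((↑) '' L : Set E))
    (h : ∀ x : S, (x : E) ∈ S.extremePoints ℝ → x ∈ L) : L = Set.univ := by
  refine Set.eq_univ_of_forall fun x => ?_
  refine mem_of_mem_closure_convexHull hS (A := {x | (x : E) ∈ S.extremePoints ℝ}) hL hLc h ?_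
  have : ((↑) '' {x : S | (x : E) ∈ S.extremePoints ℝ} : Set E) = S.extremePoints ℝ := by
    ext y
    constructor
    · rintro ⟨y, hy, rfl⟩
      exact hy
    · exact fun hy => ⟨⟨y, hy.1⟩, hy, rfl⟩
  rw [this, closure_convexHull_extremePoints hS hSc]
  exact x.2

/-- The fibre of an extremal point is compact, and its extremal points are extremal. -/
theorem extremePoints_fibre [T2Space F] {S : Set E} {T : Set F} (hS : IsCompact S)
    {f : S → T} (hf : Continuous f) (hfa : PreservesConvexComb f) {e : T}
    (he : (e : F) ∈ T.extremePoints ℝ) :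
    IsCompact ((↑) '' (f ⁻¹' {e}) : Set E) ∧
      ((↑) '' (f ⁻¹' {e}) : Set E).extremePoints ℝ ⊆ S.extremePoints ℝ := by
  have := isCompact_iff_compactSpace.1 hS
  refine ⟨(isClosed_singleton.preimage hf).isCompact.image continuous_subtype_val, ?_⟩
  -- The fibre is a face: if a point of it lies inside a segment, then `e` lies inside the image
  -- segment, so the endpoints also map to `e`.
  refine IsExtreme.extremePoints_subset_extremePoints ⟨Subtype.coe_image_subset _ _, ?_⟩
  rintro x hx y hy _ ⟨z, hz, rfl⟩ ⟨a, b, ha, hb, hab, h⟩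
  refine ⟨⟨x, hx⟩, ?_, rfl⟩
  have h1 := hfa ⟨x, hx⟩ ⟨y, hy⟩ z a b ha.le hb.le hab h.symm
  rw [Set.mem_preimage, Set.mem_singleton_iff] at hz
  rw [hz] at h1
  exact Subtype.ext ((mem_extremePoints_iff_left.1 he).2 _ (f _).2 _ (f ⟨y, hy⟩).2
    ⟨a, b, ha, hb, hab, h1.symm⟩)

theorem exists_extremePoint_of_surjective [T2Space F] {S : Set E} {T : Set F} (hS : IsCompact S)
    {f : S → T} (hf : Continuous f) (hfa : PreservesConvexComb f) (hs : Function.Surjective f)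
    {e : T} (he : (e : F) ∈ T.extremePoints ℝ) :
    ∃ x : S, (x : E) ∈ S.extremePoints ℝ ∧ f x = e := by
  obtain ⟨h1, h2⟩ := extremePoints_fibre hS hf hfa he
  obtain ⟨x, hx⟩ := hs e
  obtain ⟨y, hy⟩ := h1.extremePoints_nonempty ⟨x, x, hx, rfl⟩
  obtain ⟨z, hz, rfl⟩ := hy.1
  exact ⟨z, h2 hy, hz⟩

theorem exists_dual_ne {x y : E} (h : x ≠ y) : ∃ l : E →L[ℝ] ℝ, l x ≠ l y := by
  obtain ⟨l, hl⟩ := geometric_hahn_banach_point_point h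
  exact ⟨l, hl.ne⟩

/-- The **Markov–Kakutani theorem** for one map. -/
theorem PreservesConvexComb.exists_fixedPoint {S : Set E} (hS : IsCompact S)
    {f : S → S} (hf : Continuous f) (hfa : PreservesConvexComb f) {L : Set S} (hL : IsClosed L)
    (hLc : Convex ℝ ((↑) '' L : Set E)) (hLn : L.Nonempty) (hfL : ∀ x ∈ L, f x ∈ L) :
    ∃ x ∈ L, f x = x := by
  have := isCompact_iff_compactSpace.1 hS
  have hd : Continuous fun x : S => (f x : E) - x := by fun_prop
  have hc : IsCompact ((fun x : S => (f x : E) - x) '' L) := hL.isCompact.image hd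
  have hconv : Convex ℝ ((fun x : S => (f x : E) - x) '' L) := by
    rintro _ ⟨x, hx, rfl⟩ _ ⟨y, hy, rfl⟩ a b ha hb hab
    obtain ⟨z, hz, hz'⟩ := hLc ⟨x, hx, rfl⟩ ⟨y, hy, rfl⟩ ha hb hab
    refine ⟨z, hz, ?_⟩
    dsimp only
    rw [hfa x y z a b ha hb hab hz', hz']
    module
  by_contra! hne
  have h0 : (0 : E) ∉ (fun x : S => (f x : E) - x) '' L := by
    rintro ⟨x, hx, h⟩
    exact hne x hx (Subtype.ext (sub_eq_zero.1 h))
  -- If no displacement `f x - x` vanishes, some functional exceeds `c > 0` on all of them. It then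
  -- grows linearly along an orbit, although it is bounded on the compact set.
  obtain ⟨l, c, hc0, hl⟩ := geometric_hahn_banach_point_closed hconv hc.isClosed h0
  rw [map_zero] at hc0
  obtain ⟨x, hx⟩ := hLn
  have hmem : ∀ n : ℕ, f^[n] x ∈ L := fun n => by
    induction n with
    | zero => exact hx
    | succ n ih => rw [Function.iterate_succ_apply']; exact hfL _ ih
  have hge : ∀ n : ℕ, l x + n * c ≤ l (f^[n] x : S) := fun n => by
    induction n with
    | zero => simp
    | succ n ih =>
      have := hl _ ⟨_, hmem n, rfl⟩
      rw [map_sub] at this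
      rw [Function.iterate_succ_apply']
      push_cast
      linarith
  obtain ⟨M, hM⟩ := (hS.image l.continuous).bddAbove
  obtain ⟨n, hn⟩ := exists_nat_gt ((M - l x) / c)
  rw [div_lt_iff₀ hc0] at hn
  have := hM ⟨_, (f^[n] x).2, rfl⟩
  linarith [hge n]

end ConvexSets

/-! ### The state space of a compact space -/

section States

variable {X : Type*} [TopologicalSpace X]

/-- The positive unital linear functionals on `C(X, ℝ)`, with the topology of pointwise
convergence. -/
def stateSpace (X : Type*) [TopologicalSpace X] : Set (C(X, ℝ) → ℝ) :=
  {m | (∀ f g, m (f + g) = m f + m g) ∧ (∀ (c : ℝ) f, m (c • f) = c * m f) ∧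
    (∀ f, 0 ≤ f → 0 ≤ m f) ∧ m 1 = 1}

/-- Evaluation at a point. -/
def diracState (x : X) : stateSpace X :=
  ⟨fun f => f x, by simp [stateSpace, ContinuousMap.le_def]; exact fun f hf => hf x⟩

@[simp] theorem diracState_apply (x : X) (f : C(X, ℝ)) :
    (diracState x : C(X, ℝ) → ℝ) f = f x := rfl

theorem continuous_diracState : Continuous (diracState : X → stateSpace X) :=
  Continuous.subtype_mk (continuous_pi fun f => f.continuous) _

namespace stateSpace

variable {m : C(X, ℝ) → ℝ}

theorem map_zero (hm : m ∈ stateSpace X) : m 0 = 0 := by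
  have := hm.2.1 0 0
  simpa using this

theorem map_neg (hm : m ∈ stateSpace X) (f : C(X, ℝ)) : m (-f) = - m f := by
  have := hm.2.1 (-1) f
  simpa using this

theorem map_sub (hm : m ∈ stateSpace X) (f g : C(X, ℝ)) : m (f - g) = m f - m g := by
  rw [sub_eq_add_neg, hm.1, map_neg hm, sub_eq_add_neg]

theorem mono (hm : m ∈ stateSpace X) {f g : C(X, ℝ)} (h : f ≤ g) : m f ≤ m g := by
  have := hm.2.2.1 (g - f) (sub_nonneg.2 h)
  rw [map_sub hm] at this
  linarith

theorem map_const (hm : m ∈ stateSpace X) (c : ℝ) : m (c • 1) = c := by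
  rw [hm.2.1, hm.2.2.2, mul_one]

theorem abs_le (hm : m ∈ stateSpace X) {f : C(X, ℝ)} {c : ℝ} (hc : ∀ x, |f x| ≤ c) :
    |m f| ≤ c := by
  rw [_root_.abs_le]
  constructor
  · rw [← map_const hm (-c)]
    exact mono hm fun x => by simpa using (_root_.abs_le.1 (hc x)).1
  · rw [← map_const hm c]
    exact mono hm fun x => by simpa using (_root_.abs_le.1 (hc x)).2

theorem convex : Convex ℝ (stateSpace X) := by
  rintro m hm n hn a b ha hb hab
  refine ⟨fun f g => ?_, fun c f => ?_, fun f hf => ?_, ?_⟩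
  · simp only [Pi.add_apply, Pi.smul_apply, smul_eq_mul, hm.1, hn.1]; ring
  · simp only [Pi.add_apply, Pi.smul_apply, smul_eq_mul, hm.2.1, hn.2.1]; ring
  · have := hm.2.2.1 f hf
    have := hn.2.2.1 f hf
    simp only [Pi.add_apply, Pi.smul_apply, smul_eq_mul]; positivity
  · simp [hm.2.2.2, hn.2.2.2, hab]

theorem isClosed : IsClosed (stateSpace X) := by
  have h : stateSpace X = (⋂ (f : C(X, ℝ)) (g : C(X, ℝ)), {m | m (f + g) = m f + m g}) ∩
      ((⋂ (c : ℝ) (f : C(X, ℝ)), {m | m (c • f) = c * m f}) ∩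
      ((⋂ (f : C(X, ℝ)) (_ : 0 ≤ f), {m | 0 ≤ m f}) ∩ {m | m 1 = 1})) := by
    ext m
    simp [stateSpace]
  rw [h]
  refine .inter (isClosed_iInter fun f => isClosed_iInter fun g => isClosed_eq ?_ ?_) <|
    .inter (isClosed_iInter fun f => isClosed_iInter fun g => isClosed_eq ?_ ?_) <|
    .inter (isClosed_iInter fun f => isClosed_iInter fun g => isClosed_le ?_ ?_) <|
    isClosed_eq ?_ ?_ <;> fun_prop

theorem isCompact [CompactSpace X] : IsCompact (stateSpace X) := by
  refine IsCompact.of_isClosed_subset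
    (isCompact_univ_pi fun f : C(X, ℝ) => isCompact_Icc (a := -‖f‖) (b := ‖f‖)) isClosed ?_
  intro m hm f _
  exact _root_.abs_le.1 (abs_le hm fun x => f.norm_coe_le_norm x)

variable [CompactSpace X]

/-- For `0 < f < 1`, `m` is the average, with weights `m f` and `m (1 - f)`, of the normalised
states `m (f * ·)` and `m ((1 - f) * ·)`. Extremality makes the first one equal to `m`. The bounds
`1 / 4` and `3 / 4` keep both weights positive. -/
theorem map_mul_of_mem_extremePoints (hm : m ∈ (stateSpace X).extremePoints ℝ) (f g : C(X, ℝ)) :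
    m (f * g) = m f * m g := by
  have key : ∀ f : C(X, ℝ), (∀ x, 1 / 4 ≤ f x ∧ f x ≤ 3 / 4) → ∀ g, m (f * g) = m f * m g := by
    intro f hf g
    have hs := hm.1
    have ht1 : 1 / 4 ≤ m f := by
      rw [← map_const hs (1 / 4)]; exact mono hs fun x => by simpa using (hf x).1
    have ht2 : m f ≤ 3 / 4 := by
      rw [← map_const hs (3 / 4)]; exact mono hs fun x => by simpa using (hf x).2
    have hsub : m (1 - f) = 1 - m f := by rw [map_sub hs, hs.2.2.2]
    have hstate : ∀ f : C(X, ℝ), 0 ≤ f → 0 < m f → (fun g => (m f)⁻¹ * m (f * g)) ∈ stateSpace X :=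
      fun f hf hp => ⟨fun g h => by dsimp only; rw [mul_add, hs.1]; ring,
        fun c h => by dsimp only; rw [mul_smul_comm, hs.2.1]; ring,
        fun h hh => mul_nonneg (inv_nonneg.2 hp.le) (hs.2.2.1 _ (mul_nonneg hf hh)),
        by dsimp only; rw [mul_one]; exact inv_mul_cancel₀ hp.ne'⟩
    have h1 := (mem_extremePoints_iff_left.1 hm).2 _ (hstate f (fun x => by
      simpa using (by norm_num : (0 : ℝ) ≤ 1 / 4).trans (hf x).1) (by linarith)) _
      (hstate (1 - f) (fun x => by
        have := (hf x).2
        change 0 ≤ 1 - f x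
        linarith) (by linarith))
      ⟨m f, 1 - m f, by linarith, by linarith, by ring, by
        funext h
        have h1 : m f ≠ 0 := by linarith
        have h2 : 1 - m f ≠ 0 := by linarith
        simp only [Pi.add_apply, Pi.smul_apply, smul_eq_mul, hsub]
        rw [mul_inv_cancel_left₀ h1, mul_inv_cancel_left₀ h2, ← hs.1, ← add_mul,
          add_sub_cancel, one_mul]⟩
    have h2 := congrFun h1 g
    have h3 : m f ≠ 0 := by linarith
    rw [← h2, mul_inv_cancel_left₀ h3]
  have hs := hm.1
  -- This scale gives `|s * f x| ≤ 1 / 4`, so `1 / 2 + s * f` falls under `key`; the identity for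
  -- `f` follows by linearity.
  set s : ℝ := (4 * (‖f‖ + 1))⁻¹ with hsdef
  have hspos : 0 < s := by positivity
  have hb := key ((1 / 2 : ℝ) • 1 + s • f) (fun x => by
    have h1 : |s * f x| ≤ 1 / 4 := by
      rw [abs_mul, abs_of_pos hspos, hsdef, inv_mul_le_iff₀ (by positivity)]
      have : |f x| ≤ ‖f‖ := f.norm_coe_le_norm x
      linarith
    have := _root_.abs_le.1 h1
    simp only [ContinuousMap.add_apply, ContinuousMap.smul_apply, ContinuousMap.one_apply,
      smul_eq_mul]
    constructor <;> linarith) g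
  rw [add_mul, smul_mul_assoc, smul_mul_assoc, one_mul, hs.1, hs.1, hs.2.1, hs.2.1, hs.2.1,
    hs.2.1, hs.2.2.2] at hb
  have : s * (m (f * g) - m f * m g) = 0 := by linear_combination hb
  rcases mul_eq_zero.1 this with h | h
  · exact absurd h hspos.ne'
  · linarith

/-- An extremal state is multiplicative. If it differs from each evaluation at some `f x`, the
squares `(f x - m (f x))²` have `m`-value `0`, and by compactness finitely many of them have a
strictly positive sum, which a state cannot annihilate. -/
theorem exists_eq_diracState (hm : m ∈ (stateSpace X).extremePoints ℝ) :
    ∃ x : X, m = (diracState x : C(X, ℝ) → ℝ) := by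
  have hs := hm.1
  by_contra! hne
  have h1 : ∀ x, ∃ f, m f ≠ f x := fun x => by
    by_contra! h
    exact hne x (funext h)
  choose f hf using h1
  let g : X → C(X, ℝ) := fun x => (f x - (m (f x)) • 1) * (f x - (m (f x)) • 1)
  have hg0 : ∀ x, m (g x) = 0 := fun x => by
    rw [map_mul_of_mem_extremePoints hm, map_sub hs, map_const hs, sub_self, zero_mul]
  have hgn : ∀ x y, 0 ≤ g x y := fun x y => mul_self_nonneg _
  have hgp : ∀ x, 0 < g x x := fun x => by
    refine mul_self_pos.2 ?_
    simp only [ContinuousMap.sub_apply, ContinuousMap.smul_apply, ContinuousMap.one_apply,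
      smul_eq_mul, mul_one]
    exact sub_ne_zero.2 (hf x).symm
  obtain ⟨t, ht⟩ := isCompact_univ.elim_finite_subcover (fun x => {y | 0 < g x y})
    (fun x => isOpen_lt continuous_const (g x).continuous)
    (fun x _ => Set.mem_iUnion.2 ⟨x, hgp x⟩)
  let F : C(X, ℝ) := ∑ x ∈ t, g x
  have hF0 : m F = 0 := by
    have : ∀ s : Finset X, m (∑ x ∈ s, g x) = 0 := fun s => by
      classical
      induction s using Finset.induction_on with
      | empty => simpa using map_zero hs
      | insert a s ha ih => rw [Finset.sum_insert ha, hs.1, ih, hg0, add_zero]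
    exact this t
  have hFp : ∀ y, 0 < F y := fun y => by
    obtain ⟨x, hx, hxy⟩ := Set.mem_iUnion₂.1 (ht (Set.mem_univ y))
    simp only [F, ContinuousMap.sum_apply]
    exact Finset.sum_pos' (fun z _ => hgn z y) ⟨x, hx, hxy⟩
  rcases isEmpty_or_nonempty X with hX | hX
  · have h1 : (1 : C(X, ℝ)) = 0 := by ext x; exact hX.elim x
    have := hs.2.2.2
    rw [h1, map_zero hs] at this
    exact zero_ne_one this
  · obtain ⟨x0, -, hx0⟩ := isCompact_univ.exists_isMinOn Set.univ_nonempty F.continuous.continuousOn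
    have : F x0 ≤ m F := by
      rw [← map_const hs (F x0)]
      exact mono hs fun y => by simpa using hx0 (Set.mem_univ y)
    linarith [hFp x0]

/-- A state that occurs in a decomposition of an evaluation at `x` kills every non-negative function
vanishing at `x`, in particular `|f - f x|`. -/
theorem diracState_mem_extremePoints (x : X) :
    (diracState x : C(X, ℝ) → ℝ) ∈ (stateSpace X).extremePoints ℝ := by
  refine mem_extremePoints_iff_left.2 ⟨(diracState x).2, ?_⟩
  rintro m hm n hn ⟨a, b, ha, hb, hab, h⟩
  have key : ∀ f : C(X, ℝ), 0 ≤ f → f x = 0 → m f = 0 := fun f hf hfx => by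
    have h1 := congrFun h f
    simp only [Pi.add_apply, Pi.smul_apply, smul_eq_mul, diracState_apply, hfx] at h1
    have h2 := hm.2.2.1 f hf
    have h3 := hn.2.2.1 f hf
    have h4 : a * m f = 0 := by nlinarith [mul_nonneg ha.le h2, mul_nonneg hb.le h3]
    exact (mul_eq_zero.1 h4).resolve_left ha.ne'
  funext f
  have h1 : m |f - (f x) • 1| = 0 := key _ (abs_nonneg _) (by simp)
  have h2 : m (f - (f x) • 1) ≤ m |f - (f x) • 1| := mono hm (le_abs_self _)
  have h3 : m (-(f - (f x) • 1)) ≤ m |f - (f x) • 1| := mono hm (neg_le_abs _)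
  rw [map_neg hm] at h3
  rw [h1, map_sub hm, map_const hm] at h2 h3
  rw [diracState_apply]
  linarith

/-- Krein–Milman, the extremal states being evaluations. -/
theorem eq_univ_of_diracState_mem {L : Set (stateSpace X)} (hL : IsClosed L)
    (hLc : Convex ℝ ((↑) '' L : Set (C(X, ℝ) → ℝ))) (h : ∀ x, diracState x ∈ L) :
    L = Set.univ := by
  refine eq_univ_of_extremePoints_subset isCompact convex hL hLc fun m hm => ?_
  obtain ⟨x, hx⟩ := exists_eq_diracState hm
  rw [Subtype.ext hx]
  exact h x

theorem hom_ext {F : Type*} [AddCommGroup F] [Module ℝ F] [TopologicalSpace F] [T2Space F]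
    {T : Set F} {f g : stateSpace X → T} (hf : Continuous f) (hg : Continuous g)
    (hfa : PreservesConvexComb f) (hga : PreservesConvexComb g)
    (h : ∀ x, f (diracState x) = g (diracState x)) : f = g := by
  have := eq_univ_of_diracState_mem (isClosed_eq hf hg) (hfa.convex_eqLocus convex hga) h
  exact funext fun m => Set.eq_univ_iff_forall.1 this m

end stateSpace

theorem diracState_injective [CompactSpace X] [T2Space X] :
    Function.Injective (diracState : X → stateSpace X) := by
  intro x y h
  by_contra hne
  obtain ⟨f, hf, hf1, -⟩ := exists_continuous_zero_one_of_isClosed (isClosed_singleton (x := x))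
    (isClosed_singleton (x := y)) (by simpa using hne)
  have h1 := congrFun (congrArg Subtype.val h) f
  rw [diracState_apply, diracState_apply, hf rfl, hf1 rfl] at h1
  exact zero_ne_one h1

/-- **Barycentres**: a continuous map from a compact space to a compact convex set extends to a
continuous affine map on states. -/
theorem exists_barycenter [CompactSpace X] {E : Type*} [AddCommGroup E] [Module ℝ E]
    [TopologicalSpace E] [IsTopologicalAddGroup E] [ContinuousSMul ℝ E] [LocallyConvexSpace ℝ E]
    [T2Space E] {C : Set E} (hC : IsCompact C) (hCc : Convex ℝ C) {φ : X → C}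
    (hφ : Continuous φ) :
    ∃ B : stateSpace X → C, Continuous B ∧ PreservesConvexComb B ∧
      ∀ x, B (diracState x) = φ x := by
  -- The graph of the barycentre map is constructed as the closed convex hull `R` of the pairs
  -- (evaluation at `x`, `φ x`). On `R` every functional of the second coordinate is computed by the
  -- first, so `R` is single-valued; its projection is onto because it contains the evaluations.
  let A : Set ((C(X, ℝ) → ℝ) × E) := Set.range fun x => ((diracState x : C(X, ℝ) → ℝ), (φ x : E))
  let R := closure (convexHull ℝ A)
  have hRc : Convex ℝ R := (convex_convexHull ℝ A).closure
  have hRsub : R ⊆ stateSpace X ×ˢ C := by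
    refine closure_minimal (convexHull_min ?_ (stateSpace.convex.prod hCc))
      (stateSpace.isClosed.prod hC.isClosed)
    rintro _ ⟨x, rfl⟩
    exact ⟨(diracState x).2, (φ x).2⟩
  have hRcomp : IsCompact R := (stateSpace.isCompact.prod hC).of_isClosed_subset isClosed_closure
    hRsub
  have hRA : ∀ x, ((diracState x : C(X, ℝ) → ℝ), (φ x : E)) ∈ R := fun x =>
    subset_closure (subset_convexHull ℝ A ⟨x, rfl⟩)
  have hev : ∀ (l : E →L[ℝ] ℝ), ∀ p ∈ R,
      l p.2 = p.1 ⟨fun x => l (φ x), l.continuous.comp (continuous_subtype_val.comp hφ)⟩ := by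
    intro l p hp
    let F : C(X, ℝ) := ⟨fun x => l (φ x), l.continuous.comp (continuous_subtype_val.comp hφ)⟩
    have hcl : IsClosed {p : (C(X, ℝ) → ℝ) × E | l p.2 = p.1 F} :=
      isClosed_eq (l.continuous.comp continuous_snd) ((continuous_apply F).comp continuous_fst)
    have hcv : Convex ℝ {p : (C(X, ℝ) → ℝ) × E | l p.2 = p.1 F} := by
      rintro p hp q hq a b - - -
      change l (a • p + b • q).2 = (a • p + b • q).1 F
      replace hp : l p.2 = p.1 F := hp
      replace hq : l q.2 = q.1 F := hq
      simp [hp, hq]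
    refine closure_minimal (convexHull_min ?_ hcv) hcl hp
    rintro _ ⟨x, rfl⟩
    rfl
  have huniq : ∀ p ∈ R, ∀ q ∈ R, p.1 = q.1 → p.2 = q.2 := by
    intro p hp q hq h
    by_contra hne
    obtain ⟨l, hl⟩ := exists_dual_ne hne
    exact hl (by rw [hev l p hp, hev l q hq, h])
  have hcR := isCompact_iff_compactSpace.1 hRcomp
  let π : R → stateSpace X := fun p => ⟨p.1.1, (hRsub p.2).1⟩
  have hπ : Continuous π := (continuous_fst.comp continuous_subtype_val).subtype_mk _
  have hπs : Function.Surjective π := by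
    rw [← Set.range_eq_univ]
    refine stateSpace.eq_univ_of_diracState_mem (isCompact_range hπ).isClosed ?_
      fun x => ⟨⟨_, hRA x⟩, rfl⟩
    have : ((↑) '' Set.range π : Set (C(X, ℝ) → ℝ)) = Prod.fst '' R := by
      ext m
      simp only [Set.mem_image, Set.mem_range, exists_exists_eq_and]
      exact ⟨fun ⟨p, hp⟩ => ⟨p, p.2, hp⟩, fun ⟨p, hp, h⟩ => ⟨⟨p, hp⟩, h⟩⟩
    rw [this]
    exact hRc.linear_image (LinearMap.fst ℝ (C(X, ℝ) → ℝ) E)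
  choose σ hσ using hπs
  -- The projection of the compact graph is a quotient map, so continuity of `B` can be tested on
  -- the graph, where it is the second coordinate.
  have hq : Topology.IsQuotientMap π := hπ.isClosedMap.isQuotientMap hπ (fun m => ⟨σ m, hσ m⟩)
  have hσ1 : ∀ m, (σ m).1.1 = m := fun m => congrArg Subtype.val (hσ m)
  refine ⟨fun m => ⟨(σ m).1.2, (hRsub (σ m).2).2⟩, ?_, ?_, fun x => ?_⟩
  · rw [hq.continuous_iff]
    have : ((fun m => ⟨(σ m).1.2, (hRsub (σ m).2).2⟩ : stateSpace X → C) ∘ π) =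
        fun p => ⟨p.1.2, (hRsub p.2).2⟩ := by
      funext p
      exact Subtype.ext (huniq _ (σ (π p)).2 _ p.2 (hσ1 _))
    rw [this]
    exact (continuous_snd.comp continuous_subtype_val).subtype_mk _
  · intro m n k a b ha hb hab h
    refine huniq _ (σ k).2 _ (hRc (σ m).2 (σ n).2 ha hb hab) ?_
    simp [hσ1, h]
  · exact Subtype.ext (huniq _ (σ _).2 _ (hRA x) (hσ1 _))

/-- **Milman's theorem**: the extremal points of a closed convex hull lie in the closure. -/
theorem mem_of_mem_extremePoints_closure_convexHull {E : Type*} [AddCommGroup E] [Module ℝ E]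
    [TopologicalSpace E] [IsTopologicalAddGroup E] [ContinuousSMul ℝ E] [LocallyConvexSpace ℝ E]
    [T2Space E] {C : Set E} (hC : IsCompact C) (hCc : Convex ℝ C) {A : Set C} (hA : IsClosed A)
    (h : ∀ x : C, (x : E) ∈ closure (convexHull ℝ ((↑) '' A : Set E))) {e : C}
    (he : (e : E) ∈ C.extremePoints ℝ) : e ∈ A := by
  have := isCompact_iff_compactSpace.1 hC
  have := isCompact_iff_compactSpace.1 hA.isCompact
  -- The barycentre map from the states on `A` is onto `C`, so an extremal point lifts to an
  -- extremal state, which is evaluation at a point of `A`.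
  obtain ⟨B, hB, hBa, hBd⟩ := exists_barycenter hC hCc (φ := fun a : A => (a : C))
    continuous_subtype_val
  have := isCompact_iff_compactSpace.1 (stateSpace.isCompact (X := A))
  have hBs : Function.Surjective B := by
    intro x
    refine mem_of_mem_closure_convexHull hC (L := Set.range B) (isCompact_range hB).isClosed ?_
      (fun a ha => ⟨diracState ⟨a, ha⟩, hBd _⟩) (h x)
    rw [← Set.image_univ]
    refine hBa.convex_image ?_
    rw [Set.image_univ, Subtype.range_coe]
    exact stateSpace.convex
  obtain ⟨m, hm, rfl⟩ := exists_extremePoint_of_surjective stateSpace.isCompact hB hBa hBs he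
  obtain ⟨a, ha⟩ := stateSpace.exists_eq_diracState hm
  rw [Subtype.ext ha, hBd]
  exact a.2

end States

/-! ### Morphisms of affine flows -/

namespace AffineFlow

section Morphisms

variable {G : Type u} [Group G] [TopologicalSpace G] {K : AffineFlow.{u, v} G}
  {L : AffineFlow.{u, w} G} {M : AffineFlow.{u, x} G} {H : Subgroup G}

instance (K : AffineFlow.{u, v} G) : CompactSpace K.carrier :=
  isCompact_iff_compactSpace.1 K.isCompact

theorem preservesConvexComb_smul (K : AffineFlow.{u, v} G) (g : G) :
    PreservesConvexComb (fun x : K.carrier => g • x) :=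
  K.smul_affine g

theorem IsMorphism.preservesConvexComb {f : K.carrier → L.carrier} (hf : K.IsMorphism L f) :
    PreservesConvexComb f :=
  hf.map_affine

theorem IsMorphism.id : K.IsMorphism K (fun x => x) :=
  ⟨continuous_id, fun _ _ => rfl, PreservesConvexComb.id⟩

theorem IsMorphism.comp {g : L.carrier → M.carrier} {f : K.carrier → L.carrier}
    (hg : L.IsMorphism M g) (hf : K.IsMorphism L f) : K.IsMorphism M (fun x => g (f x)) :=
  ⟨hg.continuous.comp hf.continuous, fun a x => by rw [hf.map_smul, hg.map_smul],
    hg.preservesConvexComb.comp hf.preservesConvexComb⟩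

/-- The set of `H`-fixed points. -/
def fixedSet (K : AffineFlow.{u, v} G) (H : Subgroup G) : Set K.carrier :=
  {x | ∀ h ∈ H, h • x = x}

theorem isClosed_fixedSet : IsClosed (K.fixedSet H) := by
  have : K.fixedSet H = ⋂ h ∈ H, {x | h • x = x} := by ext; simp [fixedSet]
  rw [this]
  exact isClosed_biInter fun h _ => isClosed_eq (continuous_const_smul h) continuous_id

theorem convex_fixedSet : Convex ℝ ((↑) '' K.fixedSet H : Set K.E) := by
  rintro _ ⟨x, hx, rfl⟩ _ ⟨y, hy, rfl⟩ a b ha hb hab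
  refine ⟨⟨a • (x : K.E) + b • (y : K.E), K.convex x.2 y.2 ha hb hab⟩, fun h hh => ?_, rfl⟩
  refine Subtype.ext ?_
  rw [K.smul_affine h x y _ a b ha hb hab rfl, hx h hh, hy h hh]

theorem IsMorphism.map_fixedSet {f : K.carrier → L.carrier} (hf : K.IsMorphism L f)
    {x : K.carrier} (hx : x ∈ K.fixedSet H) : f x ∈ L.fixedSet H := fun h hh => by
  rw [← hf.map_smul, hx h hh]

/-- A morphism from an affine `(G, H)`-flow to an irreducible one is onto. -/
theorem IsMorphism.surjective {f : K.carrier → L.carrier} (hf : K.IsMorphism L f)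
    (hK : K.IsRelFlow H) (hL : L.IsIrreducible H) : Function.Surjective f := by
  rw [← Set.range_eq_univ]
  refine hL.2 _ (isCompact_range hf.continuous).isClosed ?_ ?_ ?_
  · rw [← Set.image_univ]
    refine hf.preservesConvexComb.convex_image ?_
    rw [Set.image_univ, Subtype.range_coe]
    exact K.convex
  · rintro g _ ⟨x, rfl⟩
    exact ⟨g • x, hf.map_smul g x⟩
  · obtain ⟨x, hx⟩ := hK
    exact ⟨f x, ⟨x, rfl⟩, hf.map_fixedSet hx⟩

/-- Irreducible flows are rigid: the only endomorphism is the identity. -/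
theorem IsIrreducible.endomorphism_eq (hK : K.IsIrreducible H) {f : K.carrier → K.carrier}
    (hf : K.IsMorphism K f) (x : K.carrier) : f x = x := by
  obtain ⟨x₀, hx₀⟩ := hK.1
  -- Markov–Kakutani is applied inside the `H`-fixed set, so that the fixed points of `f` form a
  -- subset to which irreducibility applies.
  obtain ⟨y, hy, hfy⟩ := hf.preservesConvexComb.exists_fixedPoint K.isCompact hf.continuous
    (isClosed_fixedSet (H := H)) convex_fixedSet ⟨x₀, hx₀⟩ fun _ => hf.map_fixedSet
  have := hK.2 {x | f x = x} (isClosed_eq hf.continuous continuous_id)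
    (hf.preservesConvexComb.convex_eqLocus K.convex PreservesConvexComb.id)
    (fun g x hx => (hf.map_smul g x).trans (congrArg _ hx)) ⟨y, hfy, hy⟩
  exact Set.eq_univ_iff_forall.1 this x

/-- An isomorphism of affine flows restricts to the extremal points. -/
theorem IsMorphism.mem_ext {f : K.carrier → L.carrier} {g : L.carrier → K.carrier}
    (hg : L.IsMorphism K g) (hgf : ∀ x, g (f x) = x)
    (hfg : ∀ y, f (g y) = y) {x : K.carrier} (hx : (x : K.E) ∈ K.carrier.extremePoints ℝ) :
    (f x : L.E) ∈ L.carrier.extremePoints ℝ := by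
  refine mem_extremePoints_iff_left.2 ⟨(f x).2, ?_⟩
  rintro y hy z hz ⟨a, b, ha, hb, hab, h⟩
  have h1 := hg.map_affine ⟨y, hy⟩ ⟨z, hz⟩ (f x) a b ha.le hb.le hab h.symm
  rw [hgf] at h1
  have h2 := (mem_extremePoints_iff_left.1 hx).2 _ (g ⟨y, hy⟩).2 _ (g ⟨z, hz⟩).2
    ⟨a, b, ha, hb, hab, h1.symm⟩
  rw [← Subtype.ext h2, hfg]

/-- The homeomorphism between the extremal points of isomorphic flows. -/
def extCongr {f : K.carrier → L.carrier} {g : L.carrier → K.carrier} (hf : K.IsMorphism L f)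
    (hg : L.IsMorphism K g) (hgf : ∀ x, g (f x) = x) (hfg : ∀ y, f (g y) = y) :
    K.Ext ≃ₜ L.Ext where
  toFun x := ⟨f x.1, hg.mem_ext hgf hfg x.2⟩
  invFun y := ⟨g y.1, hf.mem_ext hfg hgf y.2⟩
  left_inv x := Subtype.ext (hgf x.1)
  right_inv y := Subtype.ext (hfg y.1)
  continuous_toFun := (hf.continuous.comp continuous_subtype_val).subtype_mk _
  continuous_invFun := (hg.continuous.comp continuous_subtype_val).subtype_mk _

/-- By rigidity, both composites are identities: morphisms in both directions between irreducible
flows are mutually inverse. -/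
theorem exists_ext_homeomorph {f : K.carrier → L.carrier} {g : L.carrier → K.carrier}
    (hK : K.IsIrreducible H) (hL : L.IsIrreducible H) (hf : K.IsMorphism L f)
    (hg : L.IsMorphism K g) :
    ∃ e : K.Ext ≃ₜ L.Ext, ∀ (a : G) (ξ : K.Ext), e (a • ξ) = a • e ξ :=
  ⟨extCongr hf hg (hK.endomorphism_eq (hg.comp hf)) (hL.endomorphism_eq (hf.comp hg)),
    fun a ξ => Subtype.ext (hf.map_smul a ξ.1)⟩

end Morphisms

/-! ### Subflows and the existence of irreducible subflows. -/

section Discrete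

variable {G : Type u} [Group G] [TopologicalSpace G] [DiscreteTopology G]

/-- The affine flow on a closed convex invariant subset. -/
def restrict (K : AffineFlow.{u, v} G) (L : Set K.carrier) (hL : IsClosed L)
    (hLc : Convex ℝ ((↑) '' L : Set K.E)) (hLi : ∀ (g : G), ∀ x ∈ L, g • x ∈ L) :
    AffineFlow.{u, v} G :=
  have hsub : ∀ y : ((↑) '' L : Set K.E), (y : K.E) ∈ K.carrier := fun y =>
    Subtype.coe_image_subset _ _ y.2
  have hmem : ∀ y : ((↑) '' L : Set K.E), (⟨y, hsub y⟩ : K.carrier) ∈ L := fun y => by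
    obtain ⟨x, hx, hxy⟩ := y.2
    exact (Subtype.ext hxy : x = ⟨y, hsub y⟩) ▸ hx
  letI act : MulAction G ((↑) '' L : Set K.E) :=
    { smul := fun g y => ⟨(g • (⟨y, hsub y⟩ : K.carrier) : K.carrier), _, hLi g _ (hmem y), rfl⟩
      one_smul := fun y => by
        have h := Subtype.ext_iff.1 (one_smul G (⟨y, hsub y⟩ : K.carrier))
        exact Subtype.ext h
      mul_smul := fun g h y => by
        have h := Subtype.ext_iff.1 (mul_smul g h (⟨y, hsub y⟩ : K.carrier))
        exact Subtype.ext h }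
  haveI : ContinuousSMul G ((↑) '' L : Set K.E) := ⟨by
    refine continuous_prod_of_discrete_left.2 fun g => Continuous.subtype_mk ?_ _
    exact continuous_subtype_val.comp
      ((continuous_const_smul g).comp (continuous_subtype_val.subtype_mk _))⟩
  { E := K.E
    carrier := (↑) '' L
    isCompact := hL.isCompact.image continuous_subtype_val
    convex := hLc
    mulAction := act
    smul_affine := fun g x y z a b ha hb hab h =>
      K.smul_affine g ⟨x, hsub x⟩ ⟨y, hsub y⟩ ⟨z, hsub z⟩ a b ha hb hab h }

variable {K : AffineFlow.{u, v} G} {H : Subgroup G}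

section Restrict

variable {L : Set K.carrier} {hL : IsClosed L} {hLc : Convex ℝ ((↑) '' L : Set K.E)}
  {hLi : ∀ (g : G), ∀ x ∈ L, g • x ∈ L}

/-- The inclusion of a subflow. -/
def restrictIncl (x : (K.restrict L hL hLc hLi).carrier) : K.carrier :=
  ⟨x.1, Subtype.coe_image_subset _ _ x.2⟩

theorem restrictIncl_mem (x : (K.restrict L hL hLc hLi).carrier) : restrictIncl x ∈ L := by
  obtain ⟨y, hy, hxy⟩ := x.2
  exact (Subtype.ext hxy : y = restrictIncl x) ▸ hy

theorem exists_restrictIncl {x : K.carrier} (hx : x ∈ L) :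
    ∃ y : (K.restrict L hL hLc hLi).carrier, restrictIncl y = x :=
  ⟨⟨(x : K.E), x, hx, rfl⟩, rfl⟩

theorem isMorphism_restrictIncl :
    (K.restrict L hL hLc hLi).IsMorphism K restrictIncl :=
  ⟨continuous_subtype_val.subtype_mk _, fun _ _ => rfl, fun _ _ _ _ _ _ _ _ h => h⟩

theorem restrictIncl_injective :
    Function.Injective (restrictIncl : (K.restrict L hL hLc hLi).carrier → K.carrier) :=
  fun _ _ h => Subtype.ext (Subtype.ext_iff.1 h :)

theorem mem_fixedSet_restrict {x : (K.restrict L hL hLc hLi).carrier} :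
    x ∈ (K.restrict L hL hLc hLi).fixedSet H ↔ restrictIncl x ∈ K.fixedSet H :=
  ⟨fun h => isMorphism_restrictIncl.map_fixedSet h, fun h a ha => restrictIncl_injective
    ((isMorphism_restrictIncl.map_smul a x).trans (h a ha))⟩

end Restrict

/-- Every affine `(G, H)`-flow contains an irreducible one. -/
theorem IsRelFlow.exists_irreducible (hK : K.IsRelFlow H) :
    ∃ (L : AffineFlow.{u, v} G) (f : L.carrier → K.carrier), L.IsIrreducible H ∧
      L.IsMorphism K f := by
  let S : Set (Set K.carrier) := {L | IsClosed L ∧ Convex ℝ ((↑) '' L : Set K.E) ∧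
    (∀ (g : G), ∀ x ∈ L, g • x ∈ L) ∧ (L ∩ K.fixedSet H).Nonempty}
  obtain ⟨L, hL⟩ : ∃ L, Minimal (· ∈ S) L := by
    -- A chain is bounded below by its intersection, which still meets the fixed set by compactness;
    -- the empty chain is bounded by the whole flow.
    refine zorn_superset S fun c hc hchain => ?_
    rcases c.eq_empty_or_nonempty with rfl | hne
    · obtain ⟨x, hx⟩ := hK
      refine ⟨Set.univ, ⟨isClosed_univ, ?_, fun _ _ _ => trivial, x, trivial, hx⟩, by simp⟩
      rw [Set.image_univ, Subtype.range_coe]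
      exact K.convex
    · have := hne.to_subtype
      refine ⟨⋂₀ c, ⟨isClosed_sInter fun s hs => (hc hs).1, ?_, ?_, ?_⟩,
        fun s hs => Set.sInter_subset_of_mem hs⟩
      · rintro _ ⟨y, hy, rfl⟩ _ ⟨z, hz, rfl⟩ a b ha hb hab
        refine ⟨⟨_, K.convex y.2 z.2 ha hb hab⟩, fun s hs => ?_, rfl⟩
        obtain ⟨w, hw, hw'⟩ := (hc hs).2.1 ⟨y, hy s hs, rfl⟩ ⟨z, hz s hs, rfl⟩ ha hb hab
        exact (Subtype.ext hw' : w = ⟨_, K.convex y.2 z.2 ha hb hab⟩) ▸ hw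
      · exact fun g x hx s hs => (hc hs).2.2.1 g x (hx s hs)
      · have := IsCompact.nonempty_iInter_of_directed_nonempty_isCompact_isClosed
          (fun s : c => (s : Set K.carrier) ∩ K.fixedSet H) ?_ (fun s => (hc s.2).2.2.2)
          (fun s => ((hc s.2).1.inter isClosed_fixedSet).isCompact)
          (fun s => (hc s.2).1.inter isClosed_fixedSet)
        · obtain ⟨x, hx⟩ := this
          rw [Set.mem_iInter] at hx
          obtain ⟨s⟩ := ‹Nonempty c›
          exact ⟨x, fun t ht => (hx ⟨t, ht⟩).1, (hx s).2⟩
        · intro s t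
          rcases hchain.total s.2 t.2 with h | h
          · exact ⟨s, subset_rfl, Set.inter_subset_inter_left _ h⟩
          · exact ⟨t, Set.inter_subset_inter_left _ h, subset_rfl⟩
  obtain ⟨h1, h2, h3, x, hx, hxf⟩ := hL.prop
  refine ⟨K.restrict L h1 h2 h3, restrictIncl, ⟨?_, fun M hM hMc hMi hMf => ?_⟩,
    isMorphism_restrictIncl⟩
  · obtain ⟨y, hy⟩ := exists_restrictIncl (hL := h1) (hLc := h2) (hLi := h3) hx
    exact ⟨y, mem_fixedSet_restrict.2 (hy ▸ hxf)⟩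
  · have hsub : restrictIncl '' M ⊆ L := by
      rintro _ ⟨y, -, rfl⟩
      exact restrictIncl_mem y
    have hmem : restrictIncl '' M ∈ S := by
      refine ⟨(hM.isCompact.image isMorphism_restrictIncl.continuous).isClosed,
        isMorphism_restrictIncl.preservesConvexComb.convex_image hMc, ?_, ?_⟩
      · rintro g _ ⟨y, hy, rfl⟩
        exact ⟨g • y, hMi g y hy, isMorphism_restrictIncl.map_smul g y⟩
      · obtain ⟨y, hy, hyf⟩ := hMf
        exact ⟨restrictIncl y, ⟨y, hy, rfl⟩, isMorphism_restrictIncl.map_fixedSet hyf⟩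
    refine Set.eq_univ_of_forall fun y => ?_
    obtain ⟨z, hz, hzy⟩ := hL.le_of_le hmem hsub (restrictIncl_mem y)
    exact restrictIncl_injective hzy ▸ hz

end Discrete

end AffineFlow

/-! ### The flow of states -/

section StateAction

variable {G : Type u} [Group G] {X : Type v} [TopologicalSpace X] [MulAction G X]
  [ContinuousConstSMul G X]

/-- Translation by a group element as a continuous map. -/
def smulMap (X : Type v) [TopologicalSpace X] [MulAction G X] [ContinuousConstSMul G X] (g : G) :
    C(X, X) :=
  ⟨fun x => g • x, continuous_const_smul g⟩

@[simp] theorem smulMap_apply (g : G) (x : X) : smulMap X g x = g • x := rfl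

instance stateSpace.instMulAction : MulAction G (stateSpace X) where
  smul g m := ⟨fun f => m.1 (f.comp (smulMap X g)), fun f h => m.2.1 (f.comp (smulMap X g)) (h.comp (smulMap X g)), fun c f => m.2.2.1 c (f.comp (smulMap X g)),
    fun f hf => m.2.2.2.1 _ fun x => hf (g • x), m.2.2.2.2⟩
  one_smul m := by
    refine Subtype.ext (funext fun f => congrArg m.1 ?_)
    ext x
    simp
  mul_smul g h m := by
    refine Subtype.ext (funext fun f => congrArg m.1 ?_)
    ext x
    simp [mul_smul]

@[simp] theorem stateSpace.smul_apply (g : G) (m : stateSpace X) (f : C(X, ℝ)) :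
    (g • m : stateSpace X).1 f = m.1 (f.comp (smulMap X g)) := rfl

@[simp] theorem smul_diracState (g : G) (x : X) : g • diracState x = diracState (g • x) := rfl

instance : ContinuousConstSMul G (stateSpace X) :=
  ⟨fun g => Continuous.subtype_mk (continuous_pi fun f =>
    (continuous_apply (f.comp (smulMap X g))).comp continuous_subtype_val) _⟩

theorem stateSpace.preservesConvexComb_smul (g : G) :
    PreservesConvexComb (fun m : stateSpace X => g • m) := by
  intro m n k a b _ _ _ h
  funext f
  exact congrFun h (f.comp (smulMap X g))

variable [CompactSpace X] [TopologicalSpace G] [DiscreteTopology G]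

/-- The affine flow of states on a compact space. -/
def AffineFlow.states (G : Type u) [Group G] [TopologicalSpace G] [DiscreteTopology G]
    (X : Type v) [TopologicalSpace X] [MulAction G X] [ContinuousConstSMul G X] [CompactSpace X] :
    AffineFlow.{u, v} G where
  E := C(X, ℝ) → ℝ
  carrier := stateSpace X
  isCompact := stateSpace.isCompact
  convex := stateSpace.convex
  continuousSMul := ⟨continuous_prod_of_discrete_left.2 fun g => continuous_const_smul g⟩
  smul_affine g := stateSpace.preservesConvexComb_smul g

/-- Barycentres of an equivariant map are equivariant. -/
theorem barycenter_smul {L : AffineFlow.{u, w} G} {φ : X → L.carrier} {B : stateSpace X → L.carrier}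
    (hB : Continuous B) (hBa : PreservesConvexComb B) (hBd : ∀ x, B (diracState x) = φ x) {g : G}
    (hφ : ∀ x, φ (g • x) = g • φ x) (m : stateSpace X) : B (g • m) = g • B m := by
  refine congrFun (stateSpace.hom_ext (hB.comp (continuous_const_smul g))
    ((continuous_const_smul g).comp hB) (hBa.comp (stateSpace.preservesConvexComb_smul g))
    ((L.preservesConvexComb_smul g).comp hBa) fun x => ?_) m
  simp [hBd, hφ]

theorem AffineFlow.exists_barycenter_morphism {L : AffineFlow.{u, w} G} {φ : X → L.carrier}
    (hφ : Continuous φ) (hφs : ∀ (g : G) x, φ (g • x) = g • φ x) :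
    ∃ B : stateSpace X → L.carrier, (AffineFlow.states G X).IsMorphism L B ∧
      ∀ x, B (diracState x) = φ x := by
  obtain ⟨B, hB, hBa, hBd⟩ := exists_barycenter L.isCompact L.convex hφ
  exact ⟨B, ⟨hB, fun g => barycenter_smul hB hBa hBd (hφs g), hBa⟩, hBd⟩

/-- The extremal points of the flow of states are the point evaluations. -/
theorem AffineFlow.exists_ext_states_homeomorph [T2Space X] :
    ∃ e : (AffineFlow.states G X).Ext ≃ₜ X,
      ∀ (g : G) (ξ : (AffineFlow.states G X).Ext), e (g • ξ) = g • e ξ := by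
  let f : X → (AffineFlow.states G X).Ext := fun x =>
    ⟨diracState x, stateSpace.diracState_mem_extremePoints x⟩
  have hf : Continuous f := continuous_diracState.subtype_mk _
  have hb : Function.Bijective f := by
    refine ⟨fun x y h => diracState_injective (congrArg Subtype.val h), fun ξ => ?_⟩
    obtain ⟨x, hx⟩ := stateSpace.exists_eq_diracState ξ.2
    exact ⟨x, Subtype.ext (Subtype.ext hx.symm)⟩
  let e : X ≃ₜ (AffineFlow.states G X).Ext :=
    Continuous.homeoOfEquivCompactToT2 (f := Equiv.ofBijective f hb) hf
  refine ⟨e.symm, fun g ξ => e.injective ?_⟩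
  obtain ⟨x, rfl⟩ := e.surjective ξ
  rw [e.apply_symm_apply, e.symm_apply_apply]
  rfl

end StateAction

/-! ### Probability measures and states -/

section Measures

variable {X : Type v} [TopologicalSpace X] [CompactSpace X] [MeasurableSpace X] [BorelSpace X]

theorem integrable_continuousMap (μ : Measure X) [IsFiniteMeasure μ] (f : C(X, ℝ)) :
    Integrable f μ :=
  (BoundedContinuousFunction.mkOfCompact f).integrable μ

/-- The state given by integration against a probability measure. -/
noncomputable def integralState (μ : ProbabilityMeasure X) : stateSpace X :=
  ⟨fun f => ∫ x, f x ∂(μ : Measure X),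
    fun f g => integral_add (integrable_continuousMap _ f) (integrable_continuousMap _ g),
    fun c f => integral_const_mul c f,
    fun f hf => integral_nonneg fun x => hf x,
    by simp⟩

theorem integralState_apply (μ : ProbabilityMeasure X) (f : C(X, ℝ)) :
    (integralState μ).1 f = ∫ x, f x ∂(μ : Measure X) := rfl

theorem integralState_diracProba (x : X) : integralState (diracProba x) = diracState x := by
  refine Subtype.ext (funext fun f => ?_)
  exact integral_dirac' _ _ f.continuous.stronglyMeasurable

/-- On a compact space the weak topology is tested by exactly the functions in `C(X, ℝ)`.
Injectivity may fail, since non-regular measures are allowed, but an inducing map suffices to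
compare closures. -/
theorem isInducing_integralState : Topology.IsInducing (integralState (X := X)) := by
  have hc : Continuous (integralState (X := X)) := by
    refine Continuous.subtype_mk (continuous_pi fun f => ?_) _
    exact ProbabilityMeasure.continuous_integral_boundedContinuousFunction
      (BoundedContinuousFunction.mkOfCompact f)
  refine Topology.isInducing_iff_nhds.2 fun μ => le_antisymm (hc.tendsto μ).le_comap ?_
  refine Filter.tendsto_id'.1 (ProbabilityMeasure.tendsto_iff_forall_integral_tendsto.2 fun f => ?_)
  have h : Continuous fun m : stateSpace X => m.1 f.toContinuousMap :=
    (continuous_apply _).comp continuous_subtype_val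
  exact (h.tendsto _).comp Filter.tendsto_comap

/-- Riesz–Markov–Kakutani. Regularity is recorded because `StronglyProximal` speaks of regular
measures only. -/
theorem exists_regular_integralState [T2Space X] (m : stateSpace X) :
    ∃ μ : ProbabilityMeasure X, (μ : Measure X).Regular ∧ integralState μ = m := by
  let Λ : CompactlySupportedContinuousMap X ℝ →ₚ[ℝ] ℝ :=
    { toFun := fun g => m.1 g.toContinuousMap
      map_add' := fun g g' => m.2.1 g.toContinuousMap g'.toContinuousMap
      map_smul' := fun c g => m.2.2.1 c g.toContinuousMap
      monotone' := fun g g' h => stateSpace.mono m.2 h }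
  have hint : ∀ f : C(X, ℝ), ∫ x, f x ∂(RealRMK.rieszMeasure Λ) = m.1 f := fun f =>
    RealRMK.integral_rieszMeasure Λ ⟨f, HasCompactSupport.of_compactSpace _⟩
  have hp : IsProbabilityMeasure (RealRMK.rieszMeasure Λ) := by
    have h1 := hint 1
    simp only [ContinuousMap.one_apply, integral_const, smul_eq_mul, mul_one, m.2.2.2.2] at h1
    exact ⟨(ENNReal.toReal_eq_one_iff _).1 h1⟩
  exact ⟨⟨_, hp⟩, RealRMK.regular_rieszMeasure Λ, Subtype.ext (funext hint)⟩

end Measures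

/-! ### Strong proximality in terms of states, and rigidity of boundaries. -/

section Proximal

variable {G : Type u} [Group G] {X : Type v} [TopologicalSpace X] [MulAction G X]
  [ContinuousConstSMul G X] [CompactSpace X] [T2Space X]

/-- Strong proximality in terms of states. -/
theorem stronglyProximal_iff : StronglyProximal G X ↔
    ∀ m : stateSpace X, ∃ x, diracState x ∈ closure (MulAction.orbit G m) := by
  let _ : MeasurableSpace X := borel X
  have _ : BorelSpace X := ⟨rfl⟩
  have hmeas : ∀ g : G, Measurable fun x : X => g • x := fun g =>
    (continuous_const_smul g).measurable
  have hmap : ∀ (μ ν : ProbabilityMeasure X) (g : G),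
      (ν : Measure X) = (μ : Measure X).map (fun y => g • y) →
        integralState ν = g • integralState μ := fun μ ν g h => by
    refine Subtype.ext (funext fun f => ?_)
    rw [integralState_apply, h, integral_map (hmeas g).aemeasurable
      f.continuous.aestronglyMeasurable]
    rfl
  constructor
  · intro h m
    obtain ⟨μ, hμ, rfl⟩ := exists_regular_integralState m
    obtain ⟨x, hx⟩ := h μ hμ
    refine ⟨x, ?_⟩
    rw [← integralState_diracProba]
    refine closure_mono ?_ (image_closure_subset_closure_image
      isInducing_integralState.continuous ⟨_, hx, rfl⟩)
    rintro _ ⟨ν, ⟨g, hg⟩, rfl⟩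
    exact ⟨g, (hmap μ ν g hg).symm⟩
  · intro h μ _
    obtain ⟨x, hx⟩ := h (integralState μ)
    refine ⟨x, ?_⟩
    rw [isInducing_integralState.closure_eq_preimage_closure_image, Set.mem_preimage]
    rw [integralState_diracProba]
    refine closure_mono ?_ hx
    rintro _ ⟨g, rfl⟩
    exact ⟨μ.map (hmeas g).aemeasurable, ⟨g, rfl⟩, hmap μ _ g rfl⟩

omit [CompactSpace X] [T2Space X] [ContinuousConstSMul G X] in
theorem closure_orbit_subset {m : X} {L : Set X} (hL : IsClosed L)
    (hLi : ∀ (g : G), ∀ x ∈ L, g • x ∈ L) (hm : m ∈ L) : closure (MulAction.orbit G m) ⊆ L :=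
  closure_minimal (by rintro _ ⟨g, rfl⟩; exact hLi g m hm) hL

omit [CompactSpace X] [T2Space X] in
theorem smul_mem_closure_orbit {m y : X} (g : G) (hy : y ∈ closure (MulAction.orbit G m)) :
    g • y ∈ closure (MulAction.orbit G m) := by
  refine map_mem_closure (continuous_const_smul g) hy ?_
  rintro _ ⟨a, rfl⟩
  exact ⟨g * a, mul_smul g a m⟩

omit [CompactSpace X] [T2Space X] [ContinuousConstSMul G X] in
theorem eq_univ_of_isMinimal [MulAction.IsMinimal G X] {L : Set X} (hL : IsClosed L)
    (hLi : ∀ (g : G), ∀ x ∈ L, g • x ∈ L) (hn : L.Nonempty) : L = Set.univ :=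
  (eq_empty_or_univ_of_smul_invariant_closed G hL fun g => by
    rintro _ ⟨x, hx, rfl⟩
    exact hLi g x hx).resolve_left hn.ne_empty

/-- An equivariant map from a minimal flow to the states of a strongly proximal flow consists of
point evaluations. -/
theorem StronglyProximal.exists_factor (hX : StronglyProximal G X) {Y : Type w}
    [TopologicalSpace Y] [MulAction G Y] [CompactSpace Y] [Nonempty Y] [MulAction.IsMinimal G Y]
    {f : Y → stateSpace X} (hf : Continuous f) (hfs : ∀ (g : G) y, f (g • y) = g • f y) :
    ∃ φ : Y → X, Continuous φ ∧ ∀ (g : G) (y : Y), φ (g • y) = g • φ y := by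
  obtain ⟨y₀⟩ := ‹Nonempty Y›
  obtain ⟨x, hx⟩ := stronglyProximal_iff.1 hX (f y₀)
  -- The range of `f` is closed and invariant, so it contains the evaluation found in an orbit
  -- closure. The points of `Y` sent to evaluations then form a non-empty closed invariant set, all
  -- of `Y` by minimality.
  have h1 : diracState x ∈ Set.range f := by
    refine closure_orbit_subset (isCompact_range hf).isClosed ?_ ⟨y₀, rfl⟩ hx
    rintro g _ ⟨y, rfl⟩
    exact ⟨g • y, hfs g y⟩
  obtain ⟨y₁, hy₁⟩ := h1
  have h2 : f ⁻¹' Set.range diracState = Set.univ := by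
    refine eq_univ_of_isMinimal (G := G)
      ((isCompact_range continuous_diracState).isClosed.preimage hf) ?_ ⟨y₁, x, hy₁.symm⟩
    rintro g y ⟨z, hz⟩
    refine ⟨g • z, ?_⟩
    rw [hfs, ← hz, smul_diracState]
  choose φ hφ using fun y => Set.eq_univ_iff_forall.1 h2 y
  refine ⟨φ, ?_, fun g y => diracState_injective ?_⟩
  · rw [(continuous_diracState.isClosedEmbedding
      (diracState_injective (X := X))).isInducing.continuous_iff]
    exact (funext hφ : diracState ∘ φ = f) ▸ hf
  · rw [hφ, hfs, ← smul_diracState, hφ]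

variable [TopologicalSpace G] [DiscreteTopology G]

/-- The flow of states of a boundary is irreducible. -/
theorem StronglyProximal.isIrreducible_states [MulAction.IsMinimal G X]
    (hX : StronglyProximal G X) {H : Subgroup G} (hr : (AffineFlow.states G X).IsRelFlow H) :
    (AffineFlow.states G X).IsIrreducible H := by
  refine ⟨hr, fun L hL hLc hLi hLn => ?_⟩
  obtain ⟨m, hm, -⟩ := hLn
  -- Strong proximality puts one evaluation into `L`, minimality puts all of them there, and
  -- Krein–Milman does the rest.
  obtain ⟨x, hx⟩ := stronglyProximal_iff.1 hX m
  have h1 : diracState ⁻¹' L = Set.univ :=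
    eq_univ_of_isMinimal (G := G) (hL.preimage continuous_diracState)
      (fun g y hy => hLi g _ hy) ⟨x, closure_orbit_subset hL hLi hm hx⟩
  exact stateSpace.eq_univ_of_diracState_mem hL hLc fun y => Set.eq_univ_iff_forall.1 h1 y

theorem AffineFlow.isRelFlow_bot {K : AffineFlow.{u, v} G} (x : K.carrier) :
    K.IsRelFlow (⊥ : Subgroup G) :=
  ⟨x, fun h hh => by rw [Subgroup.mem_bot.1 hh, one_smul]⟩

/-- Boundaries are rigid: the only endomorphism is the identity. -/
theorem StronglyProximal.endomorphism_eq [MulAction.IsMinimal G X]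
    (hX : StronglyProximal G X) {f : X → X} (hf : Continuous f)
    (hfs : ∀ (g : G) x, f (g • x) = g • f x) (x : X) : f x = x := by
  have hirr := hX.isIrreducible_states
    (AffineFlow.isRelFlow_bot (K := AffineFlow.states G X) (diracState x))
  -- The map `f` extends to an endomorphism of the flow of states, which is rigid.
  obtain ⟨B, hB, hBd⟩ := AffineFlow.exists_barycenter_morphism (L := AffineFlow.states G X)
    (φ := fun x => diracState (f x)) (continuous_diracState.comp hf)
    (fun g x => by rw [hfs]; rfl)
  exact diracState_injective ((hBd x).symm.trans (hirr.endomorphism_eq hB _))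

end Proximal

/-! ### The closure of the extremal points of an irreducible flow -/

namespace AffineFlow

variable {G : Type u} [Group G] [TopologicalSpace G] [DiscreteTopology G]
  {K : AffineFlow.{u, v} G}

/-- The closure of the set of extremal points. -/
def extClosure (K : AffineFlow.{u, v} G) : Set K.carrier :=
  closure {x | (x : K.E) ∈ K.carrier.extremePoints ℝ}

theorem smul_mem_extClosure (g : G) {x : K.carrier} (hx : x ∈ K.extClosure) :
    g • x ∈ K.extClosure :=
  map_mem_closure (continuous_const_smul g) hx fun _ h => K.smul_mem_ext g h

instance extClosure.instMulAction (K : AffineFlow.{u, v} G) : MulAction G K.extClosure where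
  smul g x := ⟨g • x.1, smul_mem_extClosure g x.2⟩
  one_smul x := Subtype.ext (one_smul G x.1)
  mul_smul g h x := Subtype.ext (mul_smul g h x.1)

instance extClosure.instContinuousConstSMul (K : AffineFlow.{u, v} G) :
    ContinuousConstSMul G K.extClosure :=
  ⟨fun g => ((continuous_const_smul g).comp continuous_subtype_val).subtype_mk _⟩

instance extClosure.instCompactSpace (K : AffineFlow.{u, v} G) : CompactSpace K.extClosure :=
  isCompact_iff_compactSpace.1 isClosed_closure.isCompact

theorem extClosure_nonempty (hK : K.IsIrreducible (⊥ : Subgroup G)) : Nonempty K.extClosure := by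
  obtain ⟨x, -⟩ := hK.1
  obtain ⟨e, he⟩ := K.isCompact.extremePoints_nonempty ⟨x, x.2⟩
  exact ⟨⟨⟨e, he.1⟩, subset_closure he⟩⟩

/-- In an irreducible flow, every orbit closure contains the extremal points. -/
theorem IsIrreducible.mem_closure_orbit (hK : K.IsIrreducible (⊥ : Subgroup G)) (x : K.carrier)
    {e : K.carrier} (he : (e : K.E) ∈ K.carrier.extremePoints ℝ) :
    e ∈ closure (MulAction.orbit G x) := by
  -- By Milman it suffices that the closed convex hull of the orbit closure is all of `K`. This hull
  -- is invariant, so irreducibility for the trivial group gives it.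
  refine mem_of_mem_extremePoints_closure_convexHull K.isCompact K.convex isClosed_closure ?_ he
  let A : Set K.carrier := closure (MulAction.orbit G x)
  let L : Set K.carrier := {y | (y : K.E) ∈ closure (convexHull ℝ ((↑) '' A : Set K.E))}
  have hAL : A ⊆ L := fun y hy => subset_closure (subset_convexHull ℝ _ ⟨y, hy, rfl⟩)
  have hL : IsClosed L := isClosed_closure.preimage continuous_subtype_val
  have hLc : Convex ℝ ((↑) '' L : Set K.E) := by
    have : ((↑) '' L : Set K.E) =
        K.carrier ∩ closure (convexHull ℝ ((↑) '' A : Set K.E)) :=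
      Subtype.image_preimage_coe _ _
    rw [this]
    exact K.convex.inter (convex_convexHull ℝ _).closure
  have hx : x ∈ L := hAL (subset_closure (MulAction.mem_orbit_self x))
  have := hK.2 L hL hLc (fun g y hy => ?_) ⟨x, hx, fun h hh => by
    rw [Subgroup.mem_bot.1 hh, one_smul]⟩
  · exact fun y => Set.eq_univ_iff_forall.1 this y
  · exact mem_of_mem_closure_convexHull K.isCompact (L := (fun z => g • z) ⁻¹' L)
      (hL.preimage (continuous_const_smul g))
      ((K.preservesConvexComb_smul g).convex_preimage K.convex hLc)
      (fun z hz => hAL (smul_mem_closure_orbit g hz)) hy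

/-- The barycentre morphism of the closure of the extremal points. -/
theorem exists_barycenter_extClosure (K : AffineFlow.{u, v} G) :
    ∃ B : stateSpace K.extClosure → K.carrier, (states G K.extClosure).IsMorphism K B ∧
      ∀ y, B (diracState y) = y :=
  exists_barycenter_morphism continuous_subtype_val fun _ _ => rfl

/-- **Bauer's theorem**: a state with extremal barycentre is a point evaluation. -/
theorem eq_diracState_of_barycenter {B : stateSpace K.extClosure → K.carrier}
    (hB : (states G K.extClosure).IsMorphism K B) (hBd : ∀ y, B (diracState y) = y)
    {m : stateSpace K.extClosure} (he : (B m : K.E) ∈ K.carrier.extremePoints ℝ) :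
    m = diracState ⟨B m, subset_closure he⟩ := by
  have hBa : PreservesConvexComb B := hB.map_affine
  -- The extremal points of the fibre over `B m` are extremal states, hence evaluations, and the
  -- point of evaluation must be `B m`. Krein–Milman then shrinks the fibre to one point.
  obtain ⟨h1, h2⟩ := extremePoints_fibre stateSpace.isCompact hB.continuous hBa he
  have hfc : Convex ℝ ((↑) '' (B ⁻¹' {B m}) : Set (C(K.extClosure, ℝ) → ℝ)) :=
    hBa.convex_preimage stateSpace.convex (by simp)
  have h3 := closure_convexHull_extremePoints h1 hfc
  have hm : (m : C(K.extClosure, ℝ) → ℝ) ∈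
      closure (convexHull ℝ (((↑) '' (B ⁻¹' {B m}) :
        Set (C(K.extClosure, ℝ) → ℝ)).extremePoints ℝ)) := by
    rw [h3]
    exact Set.mem_image_of_mem Subtype.val (Set.mem_singleton (B m))
  have hsub : ((↑) '' (B ⁻¹' {B m}) : Set (C(K.extClosure, ℝ) → ℝ)).extremePoints ℝ ⊆
      {((diracState ⟨B m, subset_closure he⟩ : stateSpace K.extClosure) : C(K.extClosure, ℝ) → ℝ)} := by
    intro n hn
    obtain ⟨y, hy⟩ := stateSpace.exists_eq_diracState (h2 hn)
    obtain ⟨k, hk, rfl⟩ := hn.1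
    have hk' := Subtype.ext hy
    subst hk'
    have : y = ⟨B m, subset_closure he⟩ := Subtype.ext ((hBd y).symm.trans hk)
    rw [this]
    rfl
  have := closure_mono (convexHull_mono hsub) hm
  rw [convexHull_singleton, closure_singleton] at this
  exact Subtype.ext this

theorem IsIrreducible.isMinimal_extClosure (hK : K.IsIrreducible (⊥ : Subgroup G)) :
    MulAction.IsMinimal G K.extClosure := by
  refine ⟨fun x => ?_⟩
  rw [Topology.IsInducing.subtypeVal.dense_iff]
  intro y
  have : (Subtype.val '' MulAction.orbit G x) = MulAction.orbit G (x : K.carrier) := by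
    ext z
    constructor
    · rintro ⟨_, ⟨g, rfl⟩, rfl⟩
      exact ⟨g, rfl⟩
    · rintro ⟨g, rfl⟩
      exact ⟨g • x, ⟨g, rfl⟩, rfl⟩
  rw [this]
  exact closure_minimal (fun e he => hK.mem_closure_orbit x he) isClosed_closure y.2

/-- The orbit closure of the barycentre of `m` contains an extremal point. By compactness it is the
barycentre of a state in the orbit closure of `m`, and Bauer's theorem makes that state an
evaluation. -/
theorem IsIrreducible.stronglyProximal_extClosure (hK : K.IsIrreducible (⊥ : Subgroup G)) :
    StronglyProximal G K.extClosure := by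
  rw [stronglyProximal_iff]
  intro m
  obtain ⟨B, hB, hBd⟩ := K.exists_barycenter_extClosure
  obtain ⟨e, he⟩ := K.isCompact.extremePoints_nonempty ⟨B m, (B m).2⟩
  have h1 := hK.mem_closure_orbit (B m) (e := ⟨e, he.1⟩) he
  have h2 : (⟨e, he.1⟩ : K.carrier) ∈ B '' closure (MulAction.orbit G m) := by
    refine closure_minimal ?_ (isClosed_closure.isCompact.image hB.continuous).isClosed h1
    rintro _ ⟨g, rfl⟩
    exact ⟨g • m, subset_closure ⟨g, rfl⟩, hB.map_smul g m⟩
  obtain ⟨n, hn, hne⟩ := h2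
  have hne' : (B n : K.E) ∈ K.carrier.extremePoints ℝ := by rw [hne]; exact he
  exact ⟨_, eq_diracState_of_barycenter hB hBd hne' ▸ hn⟩

theorem IsIrreducible.isClassicalBoundary_extClosure (hK : K.IsIrreducible (⊥ : Subgroup G)) :
    IsClassicalBoundary G K.extClosure where
  nonempty := extClosure_nonempty hK
  compactSpace := inferInstance
  t2Space := inferInstance
  continuousSMul := ⟨continuous_prod_of_discrete_left.2 fun g => continuous_const_smul g⟩
  isMinimal := hK.isMinimal_extClosure
  stronglyProximal := hK.stronglyProximal_extClosure

end AffineFlow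

/-! ### The Stone–Čech compactification -/

section StoneCechAction

variable {G : Type u} [Group G] {α : Type v} [TopologicalSpace α] [MulAction G α]
  [ContinuousConstSMul G α]

theorem StoneCech.smul_unit (g : G) (a : α) :
    g • (stoneCechUnit a : StoneCech α) = stoneCechUnit (g • a) :=
  congrFun (stoneCechExtend_extends
    ((continuous_stoneCechUnit (α := α)).comp (continuous_const_smul g))) a

instance StoneCech.instContinuousConstSMul : ContinuousConstSMul G (StoneCech α) :=
  ⟨fun g => continuous_stoneCechExtend
    ((continuous_stoneCechUnit (α := α)).comp (continuous_const_smul g))⟩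

/-- The extension of a map intertwines translations that the map intertwines. -/
theorem stoneCechExtend_smul {Y : Type w} [TopologicalSpace Y] [CompactSpace Y] [T2Space Y]
    {f : α → Y} (hf : Continuous f) {g : G} {T : Y → Y} (hT : Continuous T)
    (h : ∀ a, f (g • a) = T (f a)) (y : StoneCech α) :
    stoneCechExtend hf (g • y) = T (stoneCechExtend hf y) := by
  refine congrFun (stoneCech_hom_ext ((continuous_stoneCechExtend hf).comp
    (continuous_const_smul g)) (hT.comp (continuous_stoneCechExtend hf)) ?_) y
  funext a
  simp only [Function.comp_apply, StoneCech.smul_unit]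
  rw [stoneCechExtend_stoneCechUnit, stoneCechExtend_stoneCechUnit, h]

end StoneCechAction

/-! ### Bounded continuous functions as functions on the Stone–Čech compactification. -/

section StoneCechFunctions

variable {α : Type v} [TopologicalSpace α]

theorem stoneCech_ext {f g : C(StoneCech α, ℝ)}
    (h : ∀ a, f (stoneCechUnit a) = g (stoneCechUnit a)) : f = g :=
  ContinuousMap.coe_injective (stoneCech_hom_ext f.continuous g.continuous (funext h))

theorem stoneCech_le {f g : C(StoneCech α, ℝ)}
    (h : ∀ a, f (stoneCechUnit a) ≤ g (stoneCechUnit a)) : f ≤ g := fun y =>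
  denseRange_stoneCechUnit.induction_on y (isClosed_le f.continuous g.continuous) h

/-- Restriction of continuous functions from the Stone–Čech compactification. -/
def stoneCechRestrict (f : C(StoneCech α, ℝ)) : α →ᵇ ℝ :=
  (BoundedContinuousFunction.mkOfCompact f).compContinuous ⟨_, continuous_stoneCechUnit⟩

@[simp] theorem stoneCechRestrict_apply (f : C(StoneCech α, ℝ)) (a : α) :
    stoneCechRestrict f a = f (stoneCechUnit a) := rfl

theorem exists_stoneCech_extension (F : α →ᵇ ℝ) :
    ∃ f : C(StoneCech α, ℝ), ∀ a, f (stoneCechUnit a) = F a := by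
  have hc : Continuous fun a => (⟨F a, abs_le.1 (F.norm_coe_le_norm a)⟩ : Set.Icc (-‖F‖) ‖F‖) :=
    F.continuous.subtype_mk _
  refine ⟨⟨fun y => (stoneCechExtend hc y : Set.Icc (-‖F‖) ‖F‖),
    continuous_subtype_val.comp (continuous_stoneCechExtend hc)⟩, fun a => ?_⟩
  simp only [ContinuousMap.coe_mk, stoneCechExtend_stoneCechUnit]

/-- Extension of bounded continuous functions to the Stone–Čech compactification. -/
noncomputable def bcfExtend (F : α →ᵇ ℝ) : C(StoneCech α, ℝ) :=
  (exists_stoneCech_extension F).choose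

@[simp] theorem bcfExtend_unit (F : α →ᵇ ℝ) (a : α) : bcfExtend F (stoneCechUnit a) = F a :=
  (exists_stoneCech_extension F).choose_spec a

end StoneCechFunctions

/-! ### Amenable groups -/

section Amenable

theorem discreteAmenable_of_finite (Γ : Type u) [Group Γ] [TopologicalSpace Γ]
    [DiscreteTopology Γ] [Finite Γ] : DiscreteAmenable Γ := by
  have := Fintype.ofFinite Γ
  refine ⟨{ toFun := fun f => (Fintype.card Γ : ℝ)⁻¹ * ∑ t, f t
            map_add' := fun f g => by simp [Finset.sum_add_distrib, mul_add]
            map_smul' := fun c f => by simp [← Finset.mul_sum, mul_left_comm] },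
    fun f hf => ?_, ?_, fun g f => ?_⟩
  · exact mul_nonneg (by positivity) (Finset.sum_nonneg fun t _ => hf t)
  · simp
  · refine congrArg ((Fintype.card Γ : ℝ)⁻¹ * ·) ?_
    exact Equiv.sum_comp (Equiv.mulLeft g) fun t => f t

variable {G : Type u} [Group G] [TopologicalSpace G] [DiscreteTopology G] {H : Subgroup G}

/-- An amenable subgroup fixes a point in every non-empty affine flow. -/
theorem DiscreteAmenable.isRelFlow (hH : DiscreteAmenable H) {K : AffineFlow.{u, v} G}
    (x₀ : K.carrier) : K.IsRelFlow H := by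
  obtain ⟨m, hm0, hm1, hmi⟩ := hH
  -- The mean is an `H`-invariant state on `StoneCech H`. The orbit map of `x₀` extends to
  -- `StoneCech H`, and the barycentre of `M` under this extension is the fixed point.
  let M : stateSpace (StoneCech H) := ⟨fun f => m (stoneCechRestrict f),
    fun f g => map_add m (stoneCechRestrict f) (stoneCechRestrict g),
    fun c f => map_smul m c (stoneCechRestrict f),
    fun f hf => hm0 _ fun t => hf _, hm1⟩
  have hM : ∀ h : H, h • M = M := fun h => Subtype.ext <| funext fun f => by
    change m _ = m _
    rw [← hmi h (stoneCechRestrict f)]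
    congr 1
    ext t
    exact congrArg f (StoneCech.smul_unit h t)
  have hc : Continuous fun h : H => (h : G) • x₀ := continuous_of_discreteTopology
  obtain ⟨B, hB, hBa, hBd⟩ := exists_barycenter K.isCompact K.convex
    (continuous_stoneCechExtend hc)
  refine ⟨B M, fun h hh => ?_⟩
  have key := stateSpace.hom_ext (f := fun n => B ((⟨h, hh⟩ : H) • n)) (g := fun n => h • B n)
    (hB.comp (continuous_const_smul _)) ((continuous_const_smul h).comp hB)
    (hBa.comp (stateSpace.preservesConvexComb_smul _))
    ((K.preservesConvexComb_smul h).comp hBa) fun y => by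
      rw [smul_diracState, hBd, hBd]
      exact stoneCechExtend_smul hc (continuous_const_smul h) (fun a => mul_smul h (a : G) x₀) y
  have := congrFun key M
  rw [hM] at this
  exact this.symm

/-- For an amenable subgroup `H`, irreducibility does not depend on `H`. -/
theorem DiscreteAmenable.isIrreducible_iff (hH : DiscreteAmenable H) {K : AffineFlow.{u, v} G} :
    K.IsIrreducible H ↔ K.IsIrreducible (⊥ : Subgroup G) := by
  constructor
  · rintro ⟨⟨x, -⟩, h⟩
    refine ⟨AffineFlow.isRelFlow_bot x, fun L hL hLc hLi hLn => h L hL hLc hLi ?_⟩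
    obtain ⟨y, hy, -⟩ := hLn
    -- Amenability is applied to the subflow on `L`, so that the fixed point lies in `L`.
    obtain ⟨y', -⟩ := AffineFlow.exists_restrictIncl (hL := hL) (hLc := hLc) (hLi := hLi) hy
    obtain ⟨z, hz⟩ := hH.isRelFlow y'
    exact ⟨_, AffineFlow.restrictIncl_mem z, AffineFlow.mem_fixedSet_restrict.1 hz⟩
  · rintro ⟨⟨x, -⟩, h⟩
    refine ⟨hH.isRelFlow x, fun L hL hLc hLi hLn => h L hL hLc hLi ?_⟩
    obtain ⟨y, hy, -⟩ := hLn
    exact ⟨y, hy, fun g hg => by rw [Subgroup.mem_bot.1 hg, one_smul]⟩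

/-- Left translation of a bounded function. -/
def leftTranslate {Γ : Type u} [Group Γ] [TopologicalSpace Γ] [DiscreteTopology Γ] (g : Γ)
    (f : Γ →ᵇ ℝ) : Γ →ᵇ ℝ :=
  f.compContinuous ⟨fun t => g * t, continuous_of_discreteTopology⟩

/-- A point of `G / H` whose stabilizer in `H` is amenable supports an invariant mean. -/
theorem exists_mean_of_stabilizer
    (hint : ∀ g : G, g ∉ H → DiscreteAmenable (H ⊓ H.conjBy g : Subgroup G)) {r : G ⧸ H}
    (hr : r ≠ ((1 : G) : G ⧸ H)) :
    ∃ p : (H →ᵇ ℝ) →ₗ[ℝ] ℝ, (∀ f : H →ᵇ ℝ, (∀ t, 0 ≤ f t) → 0 ≤ p f) ∧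
      p (BoundedContinuousFunction.const H 1) = 1 ∧
      ∀ (t : H), (t : G) • r = r → ∀ f, p (leftTranslate t f) = p f := by
  obtain ⟨g, rfl⟩ := QuotientGroup.mk_surjective r
  have hg : g ∉ H := fun h => hr ((QuotientGroup.eq.2 (by simpa using h)).symm)
  obtain ⟨k, hk0, hk1, hki⟩ := hint g hg
  -- The stabilizer of the coset of `g` in `H` is `H ∩ gHg⁻¹`. Its mean becomes a mean on `H` by
  -- restricting functions along `ι`.
  let ι : C((H ⊓ H.conjBy g : Subgroup G), H) :=
    ⟨fun t => ⟨t, t.2.1⟩, continuous_of_discreteTopology⟩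
  refine ⟨{ toFun := fun f => k (f.compContinuous ι)
            map_add' := fun f f' => map_add k (f.compContinuous ι) (f'.compContinuous ι)
            map_smul' := fun c f => map_smul k c (f.compContinuous ι) },
    fun f hf => hk0 _ fun t => hf _, hk1, fun t ht f => ?_⟩
  have ht' : (t : G) ∈ H.conjBy g := by
    have h1 : g⁻¹ * (t * g) ∈ H := QuotientGroup.eq.1 (Eq.symm ht)
    exact ⟨_, h1, by simp [mul_assoc]⟩
  exact hki ⟨t, t.2, ht'⟩ (f.compContinuous ι)

/-- An equivariant family of means on `H` indexed by the points of `G / H` other than `H`. -/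
theorem exists_equivariant_means
    (hint : ∀ g : G, g ∉ H → DiscreteAmenable (H ⊓ H.conjBy g : Subgroup G)) :
    ∃ n : G ⧸ H → ((H →ᵇ ℝ) →ₗ[ℝ] ℝ), ∀ s : G ⧸ H, s ≠ ((1 : G) : G ⧸ H) →
      (∀ f : H →ᵇ ℝ, (∀ t, 0 ≤ f t) → 0 ≤ n s f) ∧
      n s (BoundedContinuousFunction.const H 1) = 1 ∧
      ∀ (h : H) f, n ((h : G) • s) f = n s (leftTranslate h f) := by
  have hfix : ∀ h : H, (h : G) • ((1 : G) : G ⧸ H) = ((1 : G) : G ⧸ H) := fun h =>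
    (QuotientGroup.eq.2 (by simp)).symm
  let rep : G ⧸ H → G ⧸ H := fun s =>
    (Quotient.mk'' s : MulAction.orbitRel.Quotient H (G ⧸ H)).out
  have hrep : ∀ s, ∃ h : H, (h : G) • rep s = s := fun s =>
    MulAction.orbitRel_apply.1 
      ((MulAction.orbitRel H (G ⧸ H)).symm' (Quotient.mk_out (s := MulAction.orbitRel H (G ⧸ H)) s))
  have hrep_smul : ∀ (h : H) s, rep ((h : G) • s) = rep s := fun h s =>
    congrArg (Quotient.out (s := MulAction.orbitRel H (G ⧸ H))) (Quotient.sound (s := MulAction.orbitRel H (G ⧸ H))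
      (MulAction.orbitRel_apply.2 ⟨h, rfl⟩))
  have hne : ∀ s, s ≠ ((1 : G) : G ⧸ H) → rep s ≠ ((1 : G) : G ⧸ H) := fun s hs h => by
    obtain ⟨a, ha⟩ := hrep s
    rw [h, hfix] at ha
    exact hs ha.symm
  have hp : ∀ r : G ⧸ H, ∃ p : (H →ᵇ ℝ) →ₗ[ℝ] ℝ, r ≠ ((1 : G) : G ⧸ H) →
      (∀ f : H →ᵇ ℝ, (∀ t, 0 ≤ f t) → 0 ≤ p f) ∧
      p (BoundedContinuousFunction.const H 1) = 1 ∧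
      ∀ (t : H), (t : G) • r = r → ∀ f, p (leftTranslate t f) = p f := fun r => by
    by_cases hr : r = ((1 : G) : G ⧸ H)
    · exact ⟨0, fun h => absurd hr h⟩
    · obtain ⟨p, hp⟩ := exists_mean_of_stabilizer hint hr
      exact ⟨p, fun _ => hp⟩
  choose p hp using hp
  choose a ha using hrep
  -- The mean at `s = a s • rep s` is the push-forward of the mean at the orbit representative under
  -- left multiplication by `a s`.
  refine ⟨fun s =>
    { toFun := fun f => p (rep s) (leftTranslate (a s) f)
      map_add' := fun f f' => map_add (p (rep s)) (leftTranslate (a s) f) (leftTranslate (a s) f')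
      map_smul' := fun c f => map_smul (p (rep s)) c (leftTranslate (a s) f) }, fun s hs => ?_⟩
  obtain ⟨h0, h1, h2⟩ := hp (rep s) (hne s hs)
  refine ⟨fun f hf => h0 _ fun t => hf _, h1, fun h f => ?_⟩
  change p (rep ((h : G) • s)) (leftTranslate (a ((h : G) • s)) f) =
    p (rep s) (leftTranslate (a s) (leftTranslate h f))
  rw [hrep_smul]
  -- Both `h * a s` and the chosen `a (h • s)` carry the representative to `h • s`. They differ by
  -- an element of its stabilizer, which preserves the mean there.
  rw [← h2 ((h * a s)⁻¹ * a ((h : G) • s)) ?_ (leftTranslate (a s) (leftTranslate h f))]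
  · congr 1
    ext t
    change f (a ((h : G) • s) * t) = f (h * (a s * ((h * a s)⁻¹ * a ((h : G) • s) * t)))
    congr 1
    group
  · have h3 := ha ((h : G) • s)
    rw [hrep_smul] at h3
    push_cast
    rw [mul_smul, h3, inv_smul_eq_iff, mul_smul, ha]

instance : DiscreteTopology (G ⧸ H) :=
  discreteTopology_iff_forall_isOpen.2 fun _ => isOpen_coinduced.2 (isOpen_discrete _)

/-- If all the intersections with proper conjugates are amenable, then an `H`-invariant mean on
`G / H` other than the point mass at `H` makes `H` amenable. -/
theorem discreteAmenable_of_fixed_state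
    (hint : ∀ g : G, g ∉ H → DiscreteAmenable (H ⊓ H.conjBy g : Subgroup G))
    {m : stateSpace (StoneCech (G ⧸ H))} (hm : ∀ h ∈ H, h • m = m)
    (hne : m ≠ diracState (stoneCechUnit ((1 : G) : G ⧸ H))) : DiscreteAmenable H := by
  classical
  set o : G ⧸ H := ((1 : G) : G ⧸ H) with ho
  have hfix : ∀ h : H, (h : G) • o = o := fun h => (QuotientGroup.eq.2 (by simp)).symm
  obtain ⟨n, hn⟩ := exists_equivariant_means hint
  let one : H →ᵇ ℝ := BoundedContinuousFunction.const H 1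
  have habs : ∀ s, s ≠ o → ∀ f : H →ᵇ ℝ, |n s f| ≤ ‖f‖ := fun s hs f => by
    obtain ⟨h0, h1, -⟩ := hn s hs
    have h2 := h0 (‖f‖ • one - f) fun t => by
      simpa [one] using (abs_le.1 (f.norm_coe_le_norm t)).2
    have h3 := h0 (‖f‖ • one + f) fun t => by
      have := (abs_le.1 (f.norm_coe_le_norm t)).1
      simp only [BoundedContinuousFunction.coe_add, BoundedContinuousFunction.coe_smul, Pi.add_apply, one,
        BoundedContinuousFunction.const_apply, smul_eq_mul, mul_one]
      linarith
    rw [map_sub, map_smul, h1, smul_eq_mul] at h2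
    rw [map_add, map_smul, h1, smul_eq_mul] at h3
    exact abs_le.2 ⟨by linarith, by linarith⟩
  -- Evaluating the family of means turns functions on `H` into functions on `G ⧸ H`, positively and
  -- equivariantly. The value `0` at the base coset makes the image of `1` the indicator of the
  -- other cosets.
  let T : (H →ᵇ ℝ) → (G ⧸ H →ᵇ ℝ) := fun f =>
    BoundedContinuousFunction.ofNormedAddCommGroupDiscrete
      (fun s => if s = o then 0 else n s f) ‖f‖ fun s => by
        split_ifs with h
        · simp
        · exact habs s h f
  have hT : ∀ f s, T f s = if s = o then 0 else n s f := fun _ _ => rfl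
  let χ := bcfExtend (T one)
  have hχ : ∀ s, χ (stoneCechUnit s) = if s = o then 0 else 1 := fun s => by
    simp only [χ, bcfExtend_unit, hT]
    split_ifs with h
    · rfl
    · exact (hn s h).2.1
  have hχ0 : 0 ≤ χ := stoneCech_le fun s => by
    rw [hχ]
    split_ifs <;> simp
  -- If `m` did not charge the complement of `o`, the bound `|f - f o| ≤ 2‖f‖ χ` would make it
  -- evaluation at `o`. So `m (T f) / m χ` below is a mean.
  have hc : 0 < m.1 χ := by
    refine lt_of_le_of_ne (m.2.2.2.1 χ hχ0) fun hzero => hne (Subtype.ext (funext fun f => ?_))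
    have hle : |f - f (stoneCechUnit o) • 1| ≤ (2 * ‖f‖) • χ := stoneCech_le fun s => by
      simp only [ContinuousMap.abs_apply, ContinuousMap.sub_apply, ContinuousMap.smul_apply,
        ContinuousMap.one_apply, smul_eq_mul, mul_one, hχ]
      split_ifs with h
      · simp [h]
      · have h1 := abs_le.1 (f.norm_coe_le_norm (stoneCechUnit s))
        have h2 := abs_le.1 (f.norm_coe_le_norm (stoneCechUnit o))
        rw [abs_le]
        constructor <;> linarith
    have h1 := stateSpace.mono m.2 ((le_abs_self _).trans hle)
    have h2 := stateSpace.mono m.2 ((neg_le_abs _).trans hle)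
    rw [stateSpace.map_neg m.2, m.2.2.1, ← hzero, stateSpace.map_sub m.2,
      stateSpace.map_const m.2] at h2
    rw [m.2.2.1, ← hzero, stateSpace.map_sub m.2, stateSpace.map_const m.2] at h1
    rw [diracState_apply]
    linarith
  refine ⟨{ toFun := fun f => (m.1 χ)⁻¹ * m.1 (bcfExtend (T f))
            map_add' := fun f f' => ?_
            map_smul' := fun c f => ?_ }, fun f hf => ?_, ?_, fun h f => ?_⟩
  · rw [← mul_add, ← m.2.1]
    refine congrArg (fun F => (m.1 χ)⁻¹ * m.1 F) (stoneCech_ext fun s => ?_)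
    simp only [ContinuousMap.add_apply, bcfExtend_unit, hT]
    split_ifs <;> simp
  · rw [RingHom.id_apply, smul_eq_mul, mul_left_comm, ← m.2.2.1 c]
    refine congrArg (fun F => (m.1 χ)⁻¹ * m.1 F) (stoneCech_ext fun s => ?_)
    simp only [ContinuousMap.smul_apply, bcfExtend_unit, hT]
    split_ifs <;> simp
  · refine mul_nonneg (inv_nonneg.2 hc.le) (m.2.2.2.1 _ (stoneCech_le fun s => ?_))
    simp only [ContinuousMap.zero_apply, bcfExtend_unit, hT]
    split_ifs with hs
    · rfl
    · exact (hn s hs).1 f hf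
  · exact inv_mul_cancel₀ hc.ne'
  · change _ * m.1 (bcfExtend (T (leftTranslate h f))) = _ * m.1 (bcfExtend (T f))
    congr 1
    -- Equivariance of the means says that `T` of the translate of `f` by `h` is `s ↦ T f (h • s)`,
    -- and `m` is invariant under `h`.
    conv_rhs => rw [← hm h h.2, stateSpace.smul_apply]
    refine congrArg m.1 (stoneCech_ext fun s => ?_)
    rw [ContinuousMap.comp_apply, smulMap_apply, StoneCech.smul_unit, bcfExtend_unit,
      bcfExtend_unit, hT, hT]
    by_cases hs : s = o
    · rw [if_pos hs, if_pos (by rw [hs, hfix])]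
    · rw [if_neg hs, if_neg (fun h' => hs (by
        rw [← inv_smul_smul (h : G) s, h']; exact hfix h⁻¹)), (hn s hs).2.2 h f]

end Amenable

/-! ### The universal irreducible flow -/

namespace AffineFlow

variable {G : Type u} [Group G] [TopologicalSpace G] [DiscreteTopology G] {H : Subgroup G}

theorem isRelFlow_states_stoneCech (H : Subgroup G) :
    (states G (StoneCech (G ⧸ H))).IsRelFlow H := by
  refine ⟨diracState (stoneCechUnit ((1 : G) : G ⧸ H)), fun h hh => ?_⟩
  change diracState (h • stoneCechUnit ((1 : G) : G ⧸ H)) = _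
  rw [StoneCech.smul_unit]
  exact congrArg (fun s : G ⧸ H => diracState (stoneCechUnit s))
    (QuotientGroup.eq.2 (by simpa using hh) : h • ((1 : G) : G ⧸ H) = ((1 : G) : G ⧸ H))

/-- The states on `β(G / H)` map to every affine `(G, H)`-flow. -/
theorem IsRelFlow.exists_morphism_states {L : AffineFlow.{u, v} G} (hL : L.IsRelFlow H) :
    ∃ f, (states G (StoneCech (G ⧸ H))).IsMorphism L f := by
  obtain ⟨x, hx⟩ := hL
  -- The orbit map of an `H`-fixed point descends to the cosets.
  let φ : G ⧸ H → L.carrier := Quotient.lift (fun g => g • x) fun a b hab => by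
    have h1 := hx _ (QuotientGroup.leftRel_apply.1 hab)
    rw [mul_smul, inv_smul_eq_iff] at h1
    exact h1.symm
  have hφ : Continuous φ := continuous_of_discreteTopology
  have hφs : ∀ (g : G) s, φ (g • s) = g • φ s := fun g s => by
    obtain ⟨a, rfl⟩ := QuotientGroup.mk_surjective s
    exact mul_smul g a x
  obtain ⟨B, hB, -⟩ := exists_barycenter_morphism (G := G) (continuous_stoneCechExtend hφ)
    fun g y => stoneCechExtend_smul hφ (continuous_const_smul g) (hφs g) y
  exact ⟨B, hB⟩

/-- Morphisms compose through the states on `StoneCech (G ⧸ H)`, and surjectivity is automatic. The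
universe of the test flows is arbitrary, which lets models in different universes be compared. -/
theorem IsIrreducible.isUniversalIrreducible {D : AffineFlow.{u, w} G} (hD : D.IsIrreducible H)
    {f : D.carrier → (states G (StoneCech (G ⧸ H))).carrier}
    (hf : D.IsMorphism (states G (StoneCech (G ⧸ H))) f) :
    IsUniversalIrreducible.{u, v, w} H D := by
  refine ⟨hD, fun L hL => ?_⟩
  obtain ⟨B, hB⟩ := hL.1.exists_morphism_states
  exact ⟨_, hB.comp hf, (hB.comp hf).surjective hD.1 hL⟩

theorem exists_ext_homeomorph_of_universal {D : AffineFlow.{u, w} G} {D' : AffineFlow.{u, v} G}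
    (hD : IsUniversalIrreducible.{u, v, w} H D) (hD' : IsUniversalIrreducible.{u, w, v} H D') :
    ∃ e : D.Ext ≃ₜ D'.Ext, ∀ (a : G) (ξ : D.Ext), e (a • ξ) = a • e ξ := by
  obtain ⟨f, hf, -⟩ := hD.2 D' hD'.1
  obtain ⟨g, hg, -⟩ := hD'.2 D hD.1
  exact exists_ext_homeomorph hD.1 hD'.1 hf hg

/-- If `H` is not amenable but its intersections with its other conjugates are, then the flow of
states on `β(G / H)` is irreducible. -/
theorem isIrreducible_states_stoneCech (hH : ¬ DiscreteAmenable H)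
    (hint : ∀ g : G, g ∉ H → DiscreteAmenable (H ⊓ H.conjBy g : Subgroup G)) :
    (states G (StoneCech (G ⧸ H))).IsIrreducible H := by
  refine ⟨isRelFlow_states_stoneCech H, fun L hL hLc hLi hLn => ?_⟩
  obtain ⟨m, hm, hmf⟩ := hLn
  have hmo : m = diracState (stoneCechUnit ((1 : G) : G ⧸ H)) := by
    by_contra hne
    exact hH (discreteAmenable_of_fixed_state hint hmf hne)
  -- The translates of the only fixed state are the evaluations at cosets, and these are dense among
  -- all evaluations.
  refine stateSpace.eq_univ_of_diracState_mem hL hLc fun y => ?_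
  refine denseRange_stoneCechUnit.induction_on (p := fun y => diracState y ∈ L) y
    (hL.preimage continuous_diracState) fun s => ?_
  obtain ⟨g, rfl⟩ := QuotientGroup.mk_surjective s
  have h1 := hLi g m hm
  have h2 : g • m = diracState (stoneCechUnit (g : G ⧸ H)) := by
    rw [hmo]
    change diracState (g • stoneCechUnit ((1 : G) : G ⧸ H)) = _
    rw [StoneCech.smul_unit]
    exact congrArg (fun a : G => diracState (stoneCechUnit (a : G ⧸ H))) (mul_one g)
  exact h2 ▸ h1

/-- The closure of the extremal points of an irreducible flow maps to every boundary that the flow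
of states of the boundary is a quotient of. -/
theorem exists_map_extClosure {K : AffineFlow.{u, w} G} (hK : K.IsIrreducible (⊥ : Subgroup G))
    {Y : Type v} [TopologicalSpace Y] [MulAction G Y] [ContinuousConstSMul G Y] [CompactSpace Y]
    [T2Space Y] (hY : StronglyProximal G Y) {f : K.carrier → (states G Y).carrier}
    (hf : K.IsMorphism (states G Y) f) :
    ∃ φ : K.extClosure → Y, Continuous φ ∧ ∀ (g : G) (y : K.extClosure), φ (g • y) = g • φ y := by
  have := extClosure_nonempty hK
  have := hK.isMinimal_extClosure
  exact hY.exists_factor (f := fun y : K.extClosure => f y)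
    (hf.continuous.comp continuous_subtype_val) fun g y => hf.map_smul g y

/-- For an amenable subgroup, a universal irreducible flow maps onto the states of every
boundary. -/
theorem IsUniversalIrreducible.exists_morphism_states (hH : DiscreteAmenable H)
    {D : AffineFlow.{u, w} G} (hD : IsUniversalIrreducible.{u, v, w} H D) {Y : Type v}
    [TopologicalSpace Y] [MulAction G Y] [ContinuousConstSMul G Y] [CompactSpace Y] [T2Space Y]
    [Nonempty Y] [MulAction.IsMinimal G Y] (hY : StronglyProximal G Y) :
    (states G Y).IsIrreducible H ∧ ∃ f, D.IsMorphism (states G Y) f := by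
  obtain ⟨y⟩ := ‹Nonempty Y›
  have h1 : (states G Y).IsIrreducible H :=
    hY.isIrreducible_states (hH.isRelFlow (K := states G Y) (diracState y))
  obtain ⟨f, hf, -⟩ := hD.2 _ h1
  exact ⟨h1, f, hf⟩

/-- The states of a boundary `Y` are irreducible, so `D` maps to them. Minimality of `D.extClosure`
and strong proximality of `Y` force this map to send `D.extClosure` to evaluations. -/
theorem IsUniversalIrreducible.isFurstenbergBoundary_extClosure (hH : DiscreteAmenable H)
    {D : AffineFlow.{u, w} G} (hD : IsUniversalIrreducible.{u, v, w} H D) :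
    IsFurstenbergBoundary.{u, v, w} G D.extClosure := by
  have hD' := hH.isIrreducible_iff.1 hD.1
  refine ⟨hD'.isClassicalBoundary_extClosure, fun Y _ _ hY => ?_⟩
  have := hY.nonempty
  have := hY.compactSpace
  have := hY.t2Space
  have := hY.continuousSMul
  have := hY.isMinimal
  obtain ⟨-, f, hf⟩ := hD.exists_morphism_states hH hY.stronglyProximal
  exact exists_map_extClosure hD' hY.stronglyProximal hf

/-- For an amenable subgroup, the extremal points of a universal irreducible flow form a closed
set. -/
theorem IsUniversalIrreducible.exists_ext_homeomorph_extClosure (hH : DiscreteAmenable H)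
    {D : AffineFlow.{u, w} G} (hD : IsUniversalIrreducible.{u, w, w} H D) :
    ∃ e : D.Ext ≃ₜ D.extClosure, ∀ (g : G) (ξ : D.Ext), e (g • ξ) = g • e ξ := by
  have hD' := hH.isIrreducible_iff.1 hD.1
  have := extClosure_nonempty hD'
  have := hD'.isMinimal_extClosure
  -- Universality gives a morphism from `D` to the states on `D.extClosure`, and barycentres give
  -- one back. Rigidity makes them inverse, so the extremal points of `D` correspond to all of
  -- `D.extClosure`.
  obtain ⟨h1, f, hf⟩ := hD.exists_morphism_states hH hD'.stronglyProximal_extClosure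
  obtain ⟨B, hB, -⟩ := D.exists_barycenter_extClosure
  obtain ⟨e₁, he₁⟩ := exists_ext_homeomorph hD.1 h1 hf hB
  obtain ⟨e₂, he₂⟩ := exists_ext_states_homeomorph (G := G) (X := D.extClosure)
  exact ⟨e₁.trans e₂, fun g ξ => by simp [he₁, he₂]⟩

end AffineFlow

/-! ### Uniqueness of the Furstenberg boundary, and the main theorem. -/

theorem IsClassicalBoundary.endomorphism_eq {G : Type u} [Group G] [TopologicalSpace G]
    [DiscreteTopology G] {X : Type v} [TopologicalSpace X] [MulAction G X]
    (hX : IsClassicalBoundary G X) {f : X → X} (hf : Continuous f)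
    (hfs : ∀ (g : G) x, f (g • x) = g • f x) (x : X) : f x = x := by
  have := hX.compactSpace
  have := hX.t2Space
  have := hX.continuousSMul
  have := hX.isMinimal
  exact hX.stronglyProximal.endomorphism_eq hf hfs x

/-- Furstenberg boundaries are unique. -/
theorem IsFurstenbergBoundary.exists_homeomorph {G : Type u} [Group G] [TopologicalSpace G]
    [DiscreteTopology G] {X : Type v} [TopologicalSpace X] [MulAction G X] {Y : Type w}
    [TopologicalSpace Y] [MulAction G Y] (hX : IsFurstenbergBoundary.{u, w, v} G X)
    (hY : IsFurstenbergBoundary.{u, v, w} G Y) :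
    ∃ e : X ≃ₜ Y, ∀ (g : G) (x : X), e (g • x) = g • e x := by
  obtain ⟨f, hf, hfs⟩ := hX.2 Y hY.1
  obtain ⟨k, hk, hks⟩ := hY.2 X hX.1
  exact ⟨{ toFun := f
           invFun := k
           left_inv := hX.1.endomorphism_eq (hk.comp hf) fun g x => by simp [hfs, hks]
           right_inv := hY.1.endomorphism_eq (hf.comp hk) fun g y => by simp [hfs, hks]
           continuous_toFun := hf
           continuous_invFun := hk }, hfs⟩

theorem theorem6p1 {G : Type u} [Group G] [TopologicalSpace G] [DiscreteTopology G]
    (H : Subgroup G) :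
    (∃ D : AffineFlow.{u, u} G, AffineFlow.IsUniversalIrreducible.{u, v, u} H D) ∧
    (¬ DiscreteAmenable H →
      (∀ g : G, g ∉ H → DiscreteAmenable (H ⊓ H.conjBy g : Subgroup G)) →
      ∀ D : AffineFlow.{u, w} G, AffineFlow.IsUniversalIrreducible.{u, u, w} H D →
        ∃ e : D.Ext ≃ₜ StoneCech (G ⧸ H), ∀ (g : G) (ξ : D.Ext), e (g • ξ) = g • e ξ) ∧
    (H.IsMalnormalIn ∨ H.IsAlmostMalnormalIn →
      ∀ g : G, g ∉ H → DiscreteAmenable (H ⊓ H.conjBy g : Subgroup G)) ∧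
    (DiscreteAmenable H →
      (∃ (X : Type u) (_ : TopologicalSpace X) (_ : MulAction G X),
        IsFurstenbergBoundary.{u, v, u} G X) ∧
      ∀ D : AffineFlow.{u, w} G, AffineFlow.IsUniversalIrreducible.{u, u, w} H D →
        ∀ (X : Type x) [TopologicalSpace X] [MulAction G X],
          IsFurstenbergBoundary.{u, u, x} G X →
            ∃ e : D.Ext ≃ₜ X, ∀ (g : G) (ξ : D.Ext), e (g • ξ) = g • e ξ) := by
  obtain ⟨D₀, f₀, hD₀, hf₀⟩ := (AffineFlow.isRelFlow_states_stoneCech H).exists_irreducible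
  refine ⟨⟨D₀, hD₀.isUniversalIrreducible hf₀⟩, fun hH hint D hD => ?_, fun hmal g hg => ?_,
    fun hH => ⟨⟨D₀.extClosure, inferInstance, inferInstance,
      (hD₀.isUniversalIrreducible hf₀).isFurstenbergBoundary_extClosure hH⟩,
      fun D hD X _ _ hX => ?_⟩⟩
  · obtain ⟨e₁, he₁⟩ := AffineFlow.exists_ext_homeomorph_of_universal hD
      ((AffineFlow.isIrreducible_states_stoneCech hH hint).isUniversalIrreducible
        AffineFlow.IsMorphism.id)
    obtain ⟨e₂, he₂⟩ := AffineFlow.exists_ext_states_homeomorph (G := G) (X := StoneCech (G ⧸ H))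
    exact ⟨e₁.trans e₂, fun g ξ => by simp [he₁, he₂]⟩
  · have : Finite (H ⊓ H.conjBy g : Subgroup G) := by
      rcases hmal with h | h
      · rw [h g hg]
        infer_instance
      · exact h g hg
    exact discreteAmenable_of_finite _
  -- The comparison passes through `D₀`, which is universal for test flows of every universe,
  -- whereas `D` is only tested against flows in the universe of `G`.
  · obtain ⟨e₁, he₁⟩ := AffineFlow.exists_ext_homeomorph_of_universal hD
      (hD₀.isUniversalIrreducible hf₀)
    obtain ⟨e₂, he₂⟩ :=
      (hD₀.isUniversalIrreducible hf₀).exists_ext_homeomorph_extClosure hH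
    obtain ⟨e₃, he₃⟩ := IsFurstenbergBoundary.exists_homeomorph
      ((hD₀.isUniversalIrreducible hf₀).isFurstenbergBoundary_extClosure hH) hX
    exact ⟨(e₁.trans e₂).trans e₃, fun g ξ => by simp [he₁, he₂, he₃]⟩
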